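/- All graphs are finite and undirected, with nonnegative edge capacities. For a graph $G=(V,E)$ with capacities $c$, a terminal set $K\subseteq V$ and $U\subseteq K$, let $h^G_K(U)$ be the minimum, over all $A\subseteq V$ with $A\cap K=U$, of the total capacity of the edges between $A$ and $V\setminus A$. A mimicking network of $(G,K)$ is a capacitated graph $H=(V_H,E_H)$ with $K\subseteq V_H$ and $h^H_K(U)=h^G_K(U)$ for all $U\subseteq K$. It is contraction-based if there is a map $f:V\to V_H$ with $f(t)=t$ for $t\in K$ such that distinct $y,z\in V_H$ are adjacent exactly when some edge of $G$ joins $f^{-1}(y)$ and $f^{-1}(z)$, and the capacity of $yz$ is the total capacity of the edges of $G$ joining $f^{-1}(y)$ and $f^{-1}(z)$. **Theorem.** Let $T$ be a capacitated tree and $K$ a set of $k\ge 1$ terminals of $T$. 1. $(T,K)$ has a contraction-based mimicking network $T_H$ that is a tree and has at most $2k-1$ vertices, and at most $2k-2$ vertices if $k\ge 2$. 2. The bound $2k-2$ is tight for contraction-based mimicking networks, for every $k\ge 2$: if $T$ is a tree in which every vertex has degree $1$ or $3$, all edges have the same positive capacity, and $K$ is the set of the $k$ leaves of $T$, then every contraction-based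 mimicking network of $(T,K)$ has at least $2k-2$ vertices; and such a tree exists for every $k\ge 2$. 3. If $k\ge 3$, then $(T,K)$ has a mimicking network with at most $\frac{13k}{8}-\frac32$ vertices that is outerplanar (it can be drawn in the plane without crossings with all vertices on the boundary of the unbounded face) and a cactus (it is connected and any two distinct cycles share at most one vertex). -/

import Mathlib

universe u w

/-- An undirected capacitated graph on the vertex type `V`: a simple graph together with a
nonnegative capacity for each of its edges, extended by `0` to the pairs that are not edges. -/
structure CapGraph (V : Type*) where
  graph : SimpleGraph V
  cap : V → V → ℝ
  cap_symm : ∀ u v, cap u v = cap v u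
  cap_nonneg : ∀ u v, 0 ≤ cap u v
  cap_eq_zero : ∀ u v, ¬ graph.Adj u v → cap u v = 0

namespace CapGraph

open scoped Classical in
/-- The cut function: the total capacity of the edges with one end in `A` and the other outside
`A` (each such edge is counted once, from its end in `A`). -/
noncomputable def cutValue {V : Type*} [Fintype V] (G : CapGraph V) (A : Finset V) : ℝ :=
  ∑ u ∈ A, ∑ v ∈ Aᶜ, G.cap u v

/-- The terminal cut function. The terminals are the vertices `τ t`; the value at a set `U` of
terminals is the minimum of the cut function over all vertex sets `A` that contain the
terminals in `U` and no other terminal. -/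
noncomputable def minCut {V κ : Type*} [Fintype V] (G : CapGraph V) (τ : κ ↪ V) (U : Set κ) : ℝ :=
  sInf {x : ℝ | ∃ A : Finset V, (∀ t, τ t ∈ A ↔ t ∈ U) ∧ x = G.cutValue A}

/-- The infimum in `minCut` is an attained minimum. -/
theorem minCut_isLeast {V κ : Type*} [Fintype V] (G : CapGraph V) (τ : κ ↪ V) (U : Set κ) :
    IsLeast {x : ℝ | ∃ A : Finset V, (∀ t, τ t ∈ A ↔ t ∈ U) ∧ x = G.cutValue A}
      (G.minCut τ U) := by
  classical
  have hfin : {x : ℝ | ∃ A : Finset V, (∀ t, τ t ∈ A ↔ t ∈ U) ∧ x = G.cutValue A}.Finite := by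
    refine (Set.finite_range G.cutValue).subset ?_
    rintro x ⟨A, -, rfl⟩
    exact ⟨A, rfl⟩
  have hne : {x : ℝ | ∃ A : Finset V, (∀ t, τ t ∈ A ↔ t ∈ U) ∧ x = G.cutValue A}.Nonempty := by
    refine ⟨_, Finset.univ.filter (fun v => v ∈ τ '' U), fun t => ?_, rfl⟩
    simp
  exact ⟨hne.csInf_mem hfin, fun x hx => csInf_le hfin.bddBelow hx⟩

/-- `H` is a mimicking network of `G` for the terminal set `K`. The inclusion of `K` into the
vertex set of `H` is the injection `ι`; every minimum terminal cut has the same value in both. -/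
def IsMimicking {V W : Type*} [Fintype V] [Fintype W] (G : CapGraph V) (K : Finset V)
    (H : CapGraph W) (ι : K ↪ W) : Prop :=
  ∀ U : Set K, H.minCut ι U = G.minCut (Function.Embedding.subtype (· ∈ K)) U

open scoped Classical in
/-- `H` arises from `G` by merging the vertices of `G` along a map `f` that keeps the terminals:
two distinct vertices `y`, `z` of `H` are adjacent when some edge of `G` joins their preimages,
and the capacity of `yz` is the total capacity of the edges of `G` between the preimages. -/
def IsContraction {V W : Type*} [Fintype V] (G : CapGraph V) (K : Finset V)
    (H : CapGraph W) (ι : K ↪ W) : Prop :=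
  ∃ f : V → W, (∀ t : K, f t = ι t) ∧
    (∀ y z, H.graph.Adj y z ↔ y ≠ z ∧ ∃ u v, G.graph.Adj u v ∧ f u = y ∧ f v = z) ∧
    ∀ y z, y ≠ z →
      H.cap y z = ∑ u with f u = y, ∑ v with f v = z, G.cap u v

/-- A contraction-based mimicking network. -/
def IsContractionMimicking {V W : Type*} [Fintype V] [Fintype W] (G : CapGraph V) (K : Finset V)
    (H : CapGraph W) (ι : K ↪ W) : Prop :=
  G.IsContraction K H ι ∧ G.IsMimicking K H ι

open scoped Classical in
/-- `T` is a 3-regular tree (every vertex is a leaf or has degree three) with uniform positive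
edge capacities, and `K` is the set of its leaves. -/
def IsUniformCubicTree {V : Type*} [Fintype V] (T : CapGraph V) (K : Finset V) : Prop :=
  T.graph.IsTree ∧ (∀ v, T.graph.degree v = 1 ∨ T.graph.degree v = 3) ∧
    (∃ a : ℝ, 0 < a ∧ ∀ u v, T.graph.Adj u v → T.cap u v = a) ∧
    ∀ v, v ∈ K ↔ T.graph.degree v = 1

end CapGraph

/-- `S` is a simple arc in the plane from `p` to `q`. -/
def IsPlaneArc (p q : ℝ × ℝ) (S : Set (ℝ × ℝ)) : Prop :=
  ∃ γ : ℝ → ℝ × ℝ, ContinuousOn γ (Set.Icc 0 1) ∧ Set.InjOn γ (Set.Icc 0 1) ∧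
    γ 0 = p ∧ γ 1 = q ∧ γ '' Set.Icc 0 1 = S

/-- A drawing of a graph in the plane without crossings: the vertices are distinct points, each
edge is a simple arc between its ends that passes through no other vertex, and the arcs of two
distinct edges meet only in common ends. -/
structure PlaneDrawing {W : Type*} (G : SimpleGraph W) where
  pos : W → ℝ × ℝ
  arc : Sym2 W → Set (ℝ × ℝ)
  pos_injective : Function.Injective pos
  isArc : ∀ u v, G.Adj u v → IsPlaneArc (pos u) (pos v) (arc s(u, v))
  vertex_on_arc : ∀ e ∈ G.edgeSet, ∀ w, pos w ∈ arc e → w ∈ e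
  arc_inter : ∀ e ∈ G.edgeSet, ∀ e' ∈ G.edgeSet, e ≠ e' →
    arc e ∩ arc e' ⊆ pos '' {w | w ∈ e ∧ w ∈ e'}

/-- The set of points covered by a drawing. -/
def PlaneDrawing.support {W : Type*} {G : SimpleGraph W} (D : PlaneDrawing G) : Set (ℝ × ℝ) :=
  Set.range D.pos ∪ ⋃ e ∈ G.edgeSet, D.arc e

/-- A graph is outerplanar when it has a drawing in the plane without crossings in which all
vertices lie on the boundary of the unbounded face. A face is a connected component of the
complement of the drawing. -/
def IsOuterplanar {W : Type*} (G : SimpleGraph W) : Prop :=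
  ∃ D : PlaneDrawing G, ∃ x ∈ D.supportᶜ,
    ¬ Bornology.IsBounded (connectedComponentIn D.supportᶜ x) ∧
    ∀ w, D.pos w ∈ frontier (connectedComponentIn D.supportᶜ x)

/-- A cactus: a connected graph in which two distinct cycles share at most one vertex. -/
def IsCactus {W : Type*} (G : SimpleGraph W) : Prop :=
  G.Connected ∧
    ∀ (a b : W) (p : G.Walk a a) (q : G.Walk b b), p.IsCycle → q.IsCycle →
      p.toSubgraph ≠ q.toSubgraph →
      ∀ x y, x ∈ p.support → x ∈ q.support → y ∈ p.support → y ∈ q.support → x = y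

/-! Upper bound. If a nonterminal `v` of a tree has degree at most two, its heaviest edge `vu` has
at least the capacity of all its other edges together, so moving `v` to the side of `u` never
increases a cut. Hence `vu` can be contracted without changing terminal cuts (`minCut_contract`).
Repeating this leaves a tree in which every nonterminal has degree at least three. Let it have `n ≥
2` vertices, `k` of them terminals, and `d` nonterminals of degree exactly three. Since the degrees
sum to `2n - 2`, counting gives `2n + 2 ≤ 3k + d`, and `d ≤ n - k` yields `n ≤ 2k - 2`.

Tightness. In a uniform cubic tree `n = 2k - 2`, so it suffices that a contraction-based mimicking
network merges no two vertices. Suppose `x` and `y` were merged. An edge on their path gives a set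
`S` of cut value `a`, the capacity of one edge, that separates them. The network has a cut with the
same terminals and value at most `a`; it pulls back to a union of fibres `A`. The symmetric
difference of `A` and `S` consists of inner vertices and has at most two boundary edges, whereas a
nonempty set of `m` inner vertices has at least `m + 2`. So `A = S`, but `A` does not separate `x`
from `y`.

Outerplanar cactus. After the contractions, a star at a nonterminal of degree three can be replaced
by a triangle with the same minimum cuts (`cutSum_triangleCap`). This can be done simultaneously on
an independent set `I`. A tree is bipartite, so `I` can contain at least half of the `d` candidates,
and the count above leaves at most `3k/2 - 1` vertices, which implies the stated bound for `k ≥ 3`.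
A tree has a vertex order without crossing edges, triangles keep it crossing-free, and vertices
placed on a parabola in this order give an outerplanar drawing. The only cycles are the new
triangles, and two of them with two common vertices would give a cycle in the tree. -/

namespace SimpleGraph

/-! ### Parents and sparsity in trees -/

theorem Reachable.map_of_forall_adj {V W : Type*} {G : SimpleGraph V} {H : SimpleGraph W}
    {f : V → W} (hf : ∀ a b, G.Adj a b → H.Reachable (f a) (f b)) {a b : V}
    (h : G.Reachable a b) : H.Reachable (f a) (f b) := by
  obtain ⟨p⟩ := h
  induction p with
  | nil => exact .refl _
  | cons h p ih => exact (hf _ _ h).trans ih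

/-- In a tree, the neighbour of `v` that is closer to a root `r` is unique. -/
theorem IsTree.eq_of_adj_of_dist_lt {V : Type*} {G : SimpleGraph V} (hG : G.IsTree) {r v w w' : V}
    (h : G.Adj v w) (h' : G.Adj v w') (hd : G.dist r w ≤ G.dist r v)
    (hd' : G.dist r w' ≤ G.dist r v) : w = w' := by
  have key : ∀ {x : V} (hx : G.Adj v x), G.dist r x ≤ G.dist r v →
      ∃ p : G.Walk r v, p.IsPath ∧ p.penultimate = x := by
    intro x hx hdx
    obtain ⟨p, hp, hlen⟩ := hG.connected.exists_path_of_dist r x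
    -- Distances from `r` differ by exactly one across an edge, so this walk is shortest. The path
    -- from `r` to `v` is unique, and therefore so is its penultimate vertex.
    refine ⟨p.concat hx.symm, ?_, by simp⟩
    apply Walk.isPath_of_length_eq_dist
    rw [Walk.length_concat, hlen]
    rcases hG.dist_eq_dist_add_one_of_adj r hx with h1 | h1 <;> omega
  obtain ⟨p, hp, rfl⟩ := key h hd
  obtain ⟨q, hq, rfl⟩ := key h' hd'
  rw [(hG.existsUnique_path r v).unique hp hq]

open scoped Classical in
/-- Every nonempty finite set of vertices of a tree has a member with at most one neighbour in
the set. -/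
theorem IsTree.exists_card_adj_le_one {V : Type*} {G : SimpleGraph V} (hG : G.IsTree)
    {S : Finset V} (hS : S.Nonempty) : ∃ v ∈ S, (S.filter (G.Adj v)).card ≤ 1 := by
  obtain ⟨r, -⟩ := id hS
  -- For a vertex farthest from the root, every neighbour in `S` must be its parent.
  obtain ⟨v, hv, hmax⟩ := S.exists_max_image (G.dist r) hS
  refine ⟨v, hv, Finset.card_le_one.2 fun a ha b hb => ?_⟩
  rw [Finset.mem_filter] at ha hb
  exact hG.eq_of_adj_of_dist_lt ha.2 hb.2 (hmax a ha.1) (hmax b hb.1)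

open scoped Classical in
/-- A nonempty set `S` of vertices of a tree spans at most `#S - 1` edges (each counted twice). -/
theorem IsTree.sum_card_adj_add_two_le {V : Type*} {G : SimpleGraph V} (hG : G.IsTree)
    (S : Finset V) (hS : S.Nonempty) :
    ∑ v ∈ S, (S.filter (G.Adj v)).card + 2 ≤ 2 * S.card := by
  induction hn : S.card generalizing S with
  | zero => simp_all
  | succ n ih =>
    obtain ⟨v, hv, hle⟩ := hG.exists_card_adj_le_one hS
    have hcard : (S.erase v).card = n := by rw [Finset.card_erase_of_mem hv]; omega
    have hsum : ∑ x ∈ S, (S.filter (G.Adj x)).card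
        = 2 * (S.filter (G.Adj v)).card
          + ∑ x ∈ S.erase v, ((S.erase v).filter (G.Adj x)).card := by
      rw [← Finset.add_sum_erase S _ hv]
      have h1 : ∀ x ∈ S.erase v, (S.filter (G.Adj x)).card
          = ((S.erase v).filter (G.Adj x)).card + if G.Adj v x then 1 else 0 := by
        intro x hx
        rw [Finset.filter_erase]
        split_ifs with hvx
        · rw [Finset.card_erase_of_mem (by simp [hv, hvx.symm])]
          have : 0 < (S.filter (G.Adj x)).card :=
            Finset.card_pos.2 ⟨v, by simp [hv, hvx.symm]⟩
          omega
        · rw [Finset.erase_eq_of_notMem]; · rfl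
          simp [hv, G.adj_comm x v, hvx]
      have h2 : (S.erase v).filter (G.Adj v) = S.filter (G.Adj v) := by
        rw [Finset.filter_erase, Finset.erase_eq_of_notMem (by simp)]
      rw [Finset.sum_congr rfl h1, Finset.sum_add_distrib, ← Finset.card_filter, h2]
      ring
    rcases (S.erase v).eq_empty_or_nonempty with he | he
    · have hS1 : S.card = 1 := by rw [he] at hcard; simp at hcard; omega
      obtain ⟨x, rfl⟩ := Finset.card_eq_one.1 hS1
      simp [Finset.filter_singleton] at hn ⊢
    · have := ih (S.erase v) he hcard
      omega

end SimpleGraph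

/-! ### Contractions that keep terminal cuts -/

namespace CapGraph

open scoped Classical in
/-- The cut function of an arbitrary weight function on pairs. -/
noncomputable def cutSum {V : Type*} [Fintype V] (c : V → V → ℝ) (A : Finset V) : ℝ :=
  ∑ u ∈ A, ∑ v ∈ Aᶜ, c u v

open scoped Classical in
theorem cutSum_compl {V : Type*} [Fintype V] {c : V → V → ℝ} (hc : ∀ u v, c u v = c v u)
    (A : Finset V) : cutSum c Aᶜ = cutSum c A := by
  unfold cutSum
  rw [compl_compl, Finset.sum_comm]
  simp_rw [hc]

open scoped Classical in
/-- Adding `v` to a set that contains `u` does not increase the cut if the pair `vu` outweighs all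
the other pairs at `v`. -/
theorem cutSum_insert_le {V : Type*} [Fintype V] {c : V → V → ℝ} (hc : ∀ u v, c u v = c v u)
    (h0 : ∀ u v, 0 ≤ c u v) {u v : V} (hle : ∑ x ∈ Finset.univ.erase u, c v x ≤ c v u)
    {A : Finset V} (hu : u ∈ A) (hv : v ∉ A) : cutSum c (insert v A) ≤ cutSum c A := by
  unfold cutSum
  have h1 : Aᶜ = insert v (insert v A)ᶜ := by
    ext x; by_cases hx : x = v <;> simp [hx, hv]
  have h2 : v ∉ (insert v A)ᶜ := by simp
  rw [Finset.sum_insert hv, h1, Finset.sum_congr rfl fun a _ => Finset.sum_insert h2,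
    Finset.sum_add_distrib]
  -- The pairs between `A` and the complement of `insert v A` occur on both sides; what remains
  -- compares the pairs leaving `v` with those from `A` to `v`.
  gcongr
  calc ∑ x ∈ (insert v A)ᶜ, c v x ≤ ∑ x ∈ Finset.univ.erase u, c v x := by
        refine Finset.sum_le_sum_of_subset_of_nonneg (fun x hx => ?_) fun _ _ _ => h0 _ _
        simp only [Finset.mem_compl, Finset.mem_insert, not_or] at hx
        simp only [Finset.mem_erase, Finset.mem_univ, and_true]
        rintro rfl
        exact hx.2 hu
    _ ≤ c v u := hle
    _ = c u v := hc _ _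
    _ ≤ ∑ a ∈ A, c a v := Finset.single_le_sum (f := fun a => c a v) (fun _ _ => h0 _ _) hu

open scoped Classical in
theorem cutSum_erase_le {V : Type*} [Fintype V] {c : V → V → ℝ} (hc : ∀ u v, c u v = c v u)
    (h0 : ∀ u v, 0 ≤ c u v) {u v : V} (hle : ∑ x ∈ Finset.univ.erase u, c v x ≤ c v u)
    {A : Finset V} (hu : u ∉ A) (hv : v ∈ A) : cutSum c (A.erase v) ≤ cutSum c A := by
  rw [← cutSum_compl hc A, ← cutSum_compl hc (A.erase v), Finset.compl_erase]
  exact cutSum_insert_le hc h0 hle (by simpa using hu) (by simpa using hv)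

theorem minCut_le_minCut {V W κ : Type*} [Fintype V] [Fintype W] {G : CapGraph V} {H : CapGraph W}
    {τ : κ ↪ V} {ι : κ ↪ W} {U : Set κ}
    (h : ∀ A : Finset V, (∀ t, τ t ∈ A ↔ t ∈ U) →
      ∃ B : Finset W, (∀ t, ι t ∈ B ↔ t ∈ U) ∧ H.cutValue B ≤ G.cutValue A) :
    H.minCut ι U ≤ G.minCut τ U := by
  obtain ⟨A, hA, hAe⟩ := (G.minCut_isLeast τ U).1
  obtain ⟨B, hB, hle⟩ := h A hA
  rw [hAe]
  exact ((H.minCut_isLeast ι U).2 ⟨B, hB, rfl⟩).trans hle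

open scoped Classical in
/-- `H` arises from `G` by merging vertices along `f`. -/
def IsContractionMap {V W : Type*} [Fintype V] (G : CapGraph V) (H : CapGraph W) (f : V → W) :
    Prop :=
  (∀ y z, H.graph.Adj y z ↔ y ≠ z ∧ ∃ u v, G.graph.Adj u v ∧ f u = y ∧ f v = z) ∧
    ∀ y z, y ≠ z → H.cap y z = ∑ u with f u = y, ∑ v with f v = z, G.cap u v

open scoped Classical in
/-- The graph that arises from `G` by merging vertices along `f`. -/
noncomputable def contract {V W : Type*} [Fintype V] (G : CapGraph V) (f : V → W) : CapGraph W where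
  graph :=
    { Adj := fun y z => y ≠ z ∧ ∃ u v, G.graph.Adj u v ∧ f u = y ∧ f v = z
      symm := ⟨by rintro y z ⟨h, u, v, huv, hu, hv⟩; exact ⟨h.symm, v, u, huv.symm, hv, hu⟩⟩
      loopless := ⟨by rintro y ⟨h, -⟩; exact h rfl⟩ }
  cap y z := if y = z then 0 else ∑ u with f u = y, ∑ v with f v = z, G.cap u v
  cap_symm y z := by
    by_cases h : y = z
    · simp [h]
    · rw [if_neg h, if_neg (Ne.symm h), Finset.sum_comm]
      simp_rw [G.cap_symm]
  cap_nonneg y z := by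
    split_ifs
    · exact le_rfl
    · exact Finset.sum_nonneg fun _ _ => Finset.sum_nonneg fun _ _ => G.cap_nonneg _ _
  cap_eq_zero y z h := by
    split_ifs with hyz
    · rfl
    · refine Finset.sum_eq_zero fun u hu => Finset.sum_eq_zero fun v hv => G.cap_eq_zero u v ?_
      simp only [Finset.mem_filter, Finset.mem_univ, true_and] at hu hv
      exact fun huv => h ⟨hyz, u, v, huv, hu, hv⟩

theorem isContractionMap_contract {V W : Type*} [Fintype V] (G : CapGraph V) (f : V → W) :
    G.IsContractionMap (G.contract f) f :=
  ⟨fun _ _ => Iff.rfl, fun _ _ h => if_neg h⟩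

open scoped Classical in
theorem isContractionMap_id {V : Type*} [Fintype V] (G : CapGraph V) :
    G.IsContractionMap G id := by
  refine ⟨fun y z => ?_, fun y z _ => ?_⟩
  · simpa using fun h : G.graph.Adj y z => h.ne
  · have h : ∀ y : V, Finset.univ.filter (id · = y) = {y} := fun y => by ext; simp
    rw [h, h, Finset.sum_singleton, Finset.sum_singleton]

open scoped Classical in
theorem IsContractionMap.comp {V W X : Type*} [Fintype V] [Fintype W] {G : CapGraph V}
    {H : CapGraph W} {J : CapGraph X} {f : V → W} {g : W → X} (hg : H.IsContractionMap J g)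
    (hf : G.IsContractionMap H f) : G.IsContractionMap J (g ∘ f) := by
  refine ⟨fun y z => ?_, fun y z hyz => ?_⟩
  · rw [hg.1]
    refine and_congr_right fun hyz => ⟨?_, ?_⟩
    · rintro ⟨a, b, hab, rfl, rfl⟩
      obtain ⟨-, u, v, huv, rfl, rfl⟩ := (hf.1 a b).1 hab
      exact ⟨u, v, huv, rfl, rfl⟩
    · rintro ⟨u, v, huv, rfl, rfl⟩
      exact ⟨f u, f v, (hf.1 _ _).2 ⟨fun h => hyz (congrArg g h), u, v, huv, rfl, rfl⟩, rfl, rfl⟩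
  · rw [hg.2 y z hyz]
    have h1 : ∀ a ∈ Finset.univ.filter (g · = y), ∀ b ∈ Finset.univ.filter (g · = z),
        H.cap a b = ∑ u with f u = a, ∑ v with f v = b, G.cap u v := by
      intro a ha b hb
      refine hf.2 a b fun h => hyz ?_
      simp only [Finset.mem_filter, Finset.mem_univ, true_and] at ha hb
      rw [← ha, ← hb, h]
    have h2 : ∀ (x : X) (F : V → ℝ), ∑ a with g a = x, ∑ u with f u = a, F u
        = ∑ u with (g ∘ f) u = x, F u := by
      intro x F
      rw [← Finset.sum_fiberwise_of_maps_to (s := Finset.univ.filter ((g ∘ f) · = x))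
        (t := Finset.univ.filter (g · = x)) (g := f) (by simp)]
      refine Finset.sum_congr rfl fun a ha => Finset.sum_congr ?_ fun _ _ => rfl
      ext u
      simp only [Finset.mem_filter, Finset.mem_univ, true_and, Function.comp] at ha ⊢
      exact ⟨fun h => ⟨h ▸ ha, h⟩, fun h => h.2⟩
    rw [Finset.sum_congr rfl fun a ha => Finset.sum_congr rfl (h1 a ha), ← h2]
    refine Finset.sum_congr rfl fun a _ => ?_
    rw [Finset.sum_comm]
    exact Finset.sum_congr rfl fun u _ => h2 z _

open scoped Classical in
theorem IsContractionMap.cutValue_eq {V W : Type*} [Fintype V] [Fintype W] {G : CapGraph V}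
    {H : CapGraph W} {f : V → W} (hf : G.IsContractionMap H f) (A : Finset W) :
    H.cutValue A = G.cutValue (Finset.univ.filter (f · ∈ A)) := by
  have h2 : ∀ (B : Finset W) (F : V → ℝ), ∑ a ∈ B, ∑ u with f u = a, F u
      = ∑ u with f u ∈ B, F u := by
    intro B F
    rw [← Finset.sum_fiberwise_of_maps_to (s := Finset.univ.filter (f · ∈ B))
      (t := B) (g := f) (by simp)]
    refine Finset.sum_congr rfl fun a ha => Finset.sum_congr ?_ fun _ _ => rfl
    ext u
    simp only [Finset.mem_filter, Finset.mem_univ, true_and]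
    exact ⟨fun h => ⟨h ▸ ha, h⟩, fun h => h.2⟩
  have h3 : (Finset.univ.filter (f · ∈ A))ᶜ = Finset.univ.filter (f · ∈ Aᶜ) := by
    ext; simp
  unfold cutValue
  rw [h3, ← h2]
  refine Finset.sum_congr rfl fun a ha => ?_
  rw [Finset.sum_congr rfl fun b hb => hf.2 a b fun h => Finset.mem_compl.1 hb (h ▸ ha),
    Finset.sum_comm]
  exact Finset.sum_congr rfl fun u _ => h2 _ _

/-- A contraction does not decrease the minimum terminal cuts, and keeps them if every vertex set
can be replaced by a union of fibres without increasing the cut. -/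
theorem IsContractionMap.minCut_eq {V W κ : Type*} [Fintype V] [Fintype W] {G : CapGraph V}
    {H : CapGraph W} {f : V → W} (hf : G.IsContractionMap H f) {τ : κ ↪ V} {ι : κ ↪ W}
    (hι : ∀ t, f (τ t) = ι t) (U : Set κ)
    (h : ∀ A : Finset V, ∃ B : Finset W, (∀ t, ι t ∈ B ↔ τ t ∈ A) ∧
      H.cutValue B ≤ G.cutValue A) :
    H.minCut ι U = G.minCut τ U := by
  classical
  refine le_antisymm (minCut_le_minCut fun A hA => ?_) (minCut_le_minCut fun B hB => ?_)
  · obtain ⟨B, hB, hle⟩ := h A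
    exact ⟨B, fun t => (hB t).trans (hA t), hle⟩
  · refine ⟨Finset.univ.filter (f · ∈ B), fun t => ?_, ?_⟩
    · simp [hι, hB]
    · rw [hf.cutValue_eq]

open scoped Classical in
/-- Contracting an edge of a tree gives a tree. -/
theorem contract_isTree {V : Type*} [Fintype V] {T : CapGraph V} (hT : T.graph.IsTree) {u v : V}
    (huv : T.graph.Adj v u) :
    (T.contract fun x => if h : x = v then (⟨u, huv.ne'⟩ : {x // x ≠ v}) else ⟨x, h⟩).graph.IsTree
    := by
  set f : V → {x // x ≠ v} := fun x => if h : x = v then ⟨u, huv.ne'⟩ else ⟨x, h⟩ with hfdef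
  have hf : ∀ x : {x // x ≠ v}, f x = x := fun x => by simp [hfdef, x.2]
  have hconn : (T.contract f).graph.Connected := by
    have : Nonempty {x // x ≠ v} := ⟨⟨u, huv.ne'⟩⟩
    refine SimpleGraph.Connected.mk fun x y => ?_
    have key := (hT.connected.preconnected x y).map_of_forall_adj
      (H := (T.contract f).graph) (f := f) fun a b h => ?_
    · simpa [hf] using key
    · by_cases hne : f a = f b
      · exact hne ▸ .refl _
      · exact SimpleGraph.Adj.reachable ⟨hne, _, _, h, rfl, rfl⟩
  rw [SimpleGraph.isTree_iff_connected_and_card]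
  refine ⟨hconn, le_antisymm ?_ hconn.card_vert_le_card_edgeSet_add_one⟩
  rw [Nat.card_eq_fintype_card, Nat.card_eq_fintype_card, ← SimpleGraph.edgeFinset_card]
  -- The edge `vu` disappears, so one vertex and at least one edge are lost. A connected graph with
  -- so few edges is a tree.
  have hsub : (T.contract f).graph.edgeFinset
      ⊆ (T.graph.edgeFinset.erase s(v, u)).image (Sym2.map f) := by
    intro e he
    induction e with
    | _ y z =>
    rw [SimpleGraph.mem_edgeFinset, SimpleGraph.mem_edgeSet] at he
    obtain ⟨hne, a, b, hab, rfl, rfl⟩ := he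
    refine Finset.mem_image.2 ⟨s(a, b), ?_, rfl⟩
    rw [Finset.mem_erase, SimpleGraph.mem_edgeFinset]
    refine ⟨fun h => hne ?_, hab⟩
    have hvu : f v = f u := by simp [hfdef, huv.ne']
    rcases Sym2.eq_iff.1 h with ⟨rfl, rfl⟩ | ⟨rfl, rfl⟩
    · exact hvu
    · exact hvu.symm
  have h1 := (Finset.card_le_card hsub).trans Finset.card_image_le
  rw [Finset.card_erase_of_mem (by simpa using huv)] at h1
  have h2 := hT.card_edgeFinset
  have h3 : Fintype.card {x // x ≠ v} = Fintype.card V - 1 := by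
    simp [Fintype.card_subtype_compl]
  have h4 : 0 < T.graph.edgeFinset.card := Finset.card_pos.2 ⟨s(v, u), by simpa using huv⟩
  omega

open scoped Classical in
/-- Contracting an edge `vu` at a nonterminal `v` keeps the minimum terminal cuts if the edge
outweighs all the other edges at `v`. -/
theorem minCut_contract {V κ : Type*} [Fintype V] {T : CapGraph V} {u v : V} (huv : u ≠ v)
    (hle : ∑ x ∈ Finset.univ.erase u, T.cap v x ≤ T.cap v u) {τ : κ ↪ V}
    {ι : κ ↪ {x // x ≠ v}} (hι : ∀ t, (ι t : V) = τ t) (U : Set κ) :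
    (T.contract fun x => if h : x = v then (⟨u, huv⟩ : {x // x ≠ v}) else ⟨x, h⟩).minCut ι U
      = T.minCut τ U := by
  set f : V → {x // x ≠ v} := fun x => if h : x = v then ⟨u, huv⟩ else ⟨x, h⟩ with hfdef
  have hf : ∀ x : {x // x ≠ v}, f x = x := fun x => by simp [hfdef, x.2]
  have hfv : f v = ⟨u, huv⟩ := by simp [hfdef]
  refine (T.isContractionMap_contract f).minCut_eq (fun t => by rw [← hι, hf]) U fun A => ?_
  -- `B` is `A` with `v` moved to the side of `u`, hence a union of fibres.
  obtain ⟨B, hB, hBuv, hBle⟩ : ∃ B : Finset V, (∀ x, x ≠ v → (x ∈ B ↔ x ∈ A)) ∧ (v ∈ B ↔ u ∈ B) ∧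
      T.cutValue B ≤ T.cutValue A := by
    by_cases hu : u ∈ A
    · by_cases hv : v ∈ A
      · exact ⟨A, by simp, by simp [hu, hv], le_rfl⟩
      · refine ⟨insert v A, by simp +contextual, by simp [hu], ?_⟩
        exact cutSum_insert_le T.cap_symm T.cap_nonneg hle hu hv
    · by_cases hv : v ∈ A
      · refine ⟨A.erase v, by simp +contextual, by simp [hu], ?_⟩
        exact cutSum_erase_le T.cap_symm T.cap_nonneg hle hu hv
      · exact ⟨A, by simp, by simp [hu, hv], le_rfl⟩
  refine ⟨Finset.univ.filter fun x => (x : V) ∈ B, fun t => ?_, ?_⟩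
  · simp only [Finset.mem_filter, Finset.mem_univ, true_and]
    rw [hB _ (ι t).2, hι]
  · rw [(T.isContractionMap_contract f).cutValue_eq]
    refine le_trans (le_of_eq ?_) hBle
    congr 1
    ext x
    by_cases hx : x = v
    · subst hx; simp [hfv, hBuv]
    · simp [hfdef, hx]

open scoped Classical in
/-- A tree can be contracted, keeping the minimum terminal cuts, to a tree in which every
nonterminal has degree at least three. -/
theorem exists_contraction_three_le_degree {κ : Type*} [Nonempty κ] (n : ℕ) :
    ∀ (V : Type u) [Fintype V] (T : CapGraph V) (τ : κ ↪ V), T.graph.IsTree →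
      Fintype.card V = n →
      ∃ (W : Type u) (_ : Fintype W) (H : CapGraph W) (ι : κ ↪ W) (f : V → W),
        (∀ t, f (τ t) = ι t) ∧ T.IsContractionMap H f ∧
        (∀ U, H.minCut ι U = T.minCut τ U) ∧ H.graph.IsTree ∧
        ∀ y, y ∉ Set.range ι → 3 ≤ H.graph.degree y := by
  induction n with
  | zero =>
    intro V _ T τ _ h
    have := Fintype.card_eq_zero_iff.1 h
    exact isEmptyElim (τ (Classical.arbitrary κ))
  | succ n ih =>
    intro V _ T τ hT hcard
    by_cases hall : ∀ y, y ∉ Set.range τ → 3 ≤ T.graph.degree y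
    · exact ⟨V, inferInstance, T, τ, id, fun _ => rfl, T.isContractionMap_id, fun _ => rfl, hT,
        hall⟩
    push Not at hall
    obtain ⟨v, hv, hdeg⟩ := hall
    have : Nontrivial V := ⟨v, τ (Classical.arbitrary κ), fun h => hv ⟨_, h.symm⟩⟩
    have hpos : 0 < T.graph.degree v := hT.connected.preconnected.degree_pos_of_nontrivial v
    -- At most one other edge meets `v`, and it is no heavier than the heaviest one.
    obtain ⟨u, hu, hmax⟩ := (T.graph.neighborFinset v).exists_max_image (T.cap v)
      (Finset.card_pos.1 hpos)
    rw [SimpleGraph.mem_neighborFinset] at hu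
    have hle : ∑ x ∈ Finset.univ.erase u, T.cap v x ≤ T.cap v u := by
      have h1 : ∑ x ∈ Finset.univ.erase u, T.cap v x
          = ∑ x ∈ (T.graph.neighborFinset v).erase u, T.cap v x := by
        symm
        apply Finset.sum_subset
        · exact Finset.erase_subset_erase _ (Finset.subset_univ _)
        · intro x hx hx'
          apply T.cap_eq_zero
          simp_all
      rw [h1]
      refine (Finset.sum_le_card_nsmul _ _ (T.cap v u)
        fun x hx => hmax x (Finset.mem_of_mem_erase hx)).trans ?_
      rw [Finset.card_erase_of_mem (by simpa using hu), SimpleGraph.card_neighborFinset_eq_degree,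
        nsmul_eq_mul]
      have h2 : ((T.graph.degree v - 1 : ℕ) : ℝ) ≤ 1 := by
        norm_cast; omega
      nlinarith [T.cap_nonneg v u]
    let σ : κ ↪ {x // x ≠ v} := ⟨fun t => ⟨τ t, fun h => hv ⟨t, h⟩⟩, fun s t h => by simpa using h⟩
    obtain ⟨W, hW, H, ι, g, hg, hgm, hmin, htree, hdeg'⟩ := ih {x // x ≠ v} _ σ
      (contract_isTree hT hu) (by simp [Fintype.card_subtype_compl, hcard])
    refine ⟨W, hW, H, ι, _, fun t => ?_, hgm.comp (isContractionMap_contract _ _), fun U => ?_,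
      htree, hdeg'⟩
    · rw [← hg]
      have : τ t ≠ v := fun h => hv ⟨t, h⟩
      simp only [Function.comp_apply, dif_neg this]
      rfl
    · rw [hmin]
      exact minCut_contract hu.ne' hle (fun _ => rfl) U

end CapGraph

/-! ### Degree counting -/

namespace SimpleGraph

open scoped Classical in
theorem IsTree.sum_degrees_add_two {V : Type*} [Fintype V] {G : SimpleGraph V} (hG : G.IsTree) :
    ∑ v, G.degree v + 2 = 2 * Fintype.card V := by
  rw [G.sum_degrees_eq_twice_card_edges, ← hG.card_edgeFinset]
  ring

open scoped Classical in
/-- The number of vertices of a tree in which all vertices outside `R` have degree at least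
three. -/
theorem IsTree.two_mul_card_add_two_le {V : Type*} [Fintype V] [Nontrivial V] {G : SimpleGraph V}
    (hG : G.IsTree) (R : Finset V) (h : ∀ v, v ∉ R → 3 ≤ G.degree v) :
    2 * Fintype.card V + 2 ≤
      3 * R.card + (Finset.univ.filter fun v => v ∉ R ∧ G.degree v = 3).card := by
  -- Every vertex collects at least 4: positive degree plus 3 in `R`, degree 3 plus 1, or degree at
  -- least 4. The degree sum `2n - 2` then gives the bound.
  have h1 : ∑ _v : V, 4 ≤ ∑ v, (G.degree v + 3 * (if v ∈ R then 1 else 0)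
      + if v ∉ R ∧ G.degree v = 3 then 1 else 0) := by
    refine Finset.sum_le_sum fun v _ => ?_
    have hpos : 0 < G.degree v := hG.connected.preconnected.degree_pos_of_nontrivial v
    by_cases hv : v ∈ R
    · simp [hv]; omega
    · have := h v hv
      by_cases h3 : G.degree v = 3 <;> simp [hv, h3]; omega
  rw [Finset.sum_add_distrib, Finset.sum_add_distrib, ← Finset.mul_sum, ← Finset.card_filter,
    ← Finset.card_filter, Finset.filter_mem_eq_inter, Finset.univ_inter] at h1
  have h2 := hG.sum_degrees_add_two
  simp only [Finset.sum_const, Finset.card_univ, smul_eq_mul] at h1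
  omega

end SimpleGraph

/-! ### Tightness for uniform cubic trees -/

namespace CapGraph

open scoped Classical in
-- Adding 2 to the degree of each leaf makes all degrees 3, while the degrees sum to `2n - 2`.
theorem IsUniformCubicTree.card_add_two {V : Type*} [Fintype V] {T : CapGraph V} {K : Finset V}
    (h : T.IsUniformCubicTree K) : Fintype.card V + 2 = 2 * K.card := by
  obtain ⟨hT, hdeg, -, hK⟩ := h
  have h1 : ∑ v, (T.graph.degree v + 2 * (if v ∈ K then 1 else 0)) = ∑ _v : V, 3 := by
    refine Finset.sum_congr rfl fun v _ => ?_
    by_cases hv : v ∈ K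
    · simp [hv, (hK v).1 hv]
    · simp [hv, (hdeg v).resolve_left fun h => hv ((hK v).2 h)]
  rw [Finset.sum_add_distrib, ← Finset.mul_sum, ← Finset.card_filter,
    Finset.filter_mem_eq_inter, Finset.univ_inter] at h1
  have h2 := hT.sum_degrees_add_two
  simp only [Finset.sum_const, Finset.card_univ, smul_eq_mul] at h1
  omega

open scoped Classical in
theorem cutSum_eq_sum_ite {V : Type*} [Fintype V] (c : V → V → ℝ) (A : Finset V) :
    cutSum c A = ∑ u, ∑ v, if u ∈ A ∧ v ∉ A then c u v else 0 := by
  unfold cutSum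
  simp only [ite_and]
  rw [← Finset.sum_filter_add_sum_filter_not Finset.univ (· ∈ A)]
  rw [Finset.sum_eq_zero (s := Finset.univ.filter (· ∉ A)), add_zero,
    Finset.filter_mem_eq_inter, Finset.univ_inter]
  · refine Finset.sum_congr rfl fun u hu => ?_
    simp only [hu, if_true, ← Finset.sum_filter]
    congr 1
    ext; simp
  · intro u hu
    simp only [Finset.mem_filter, Finset.mem_univ, true_and] at hu
    simp [hu]

open scoped Classical in
-- A pair separated by the symmetric difference is separated by exactly one of the two sets. Each
-- cut is added to that of its complement so that the comparison, pair by pair, does not depend on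
-- orientation.
theorem cutSum_symmDiff_le {V : Type*} [Fintype V] {c : V → V → ℝ} (hc : ∀ u v, c u v = c v u)
    (h0 : ∀ u v, 0 ≤ c u v) (A B : Finset V) :
    cutSum c (symmDiff A B) ≤ cutSum c A + cutSum c B := by
  have h : cutSum c (symmDiff A B) + cutSum c (symmDiff A B)ᶜ
      ≤ cutSum c A + cutSum c Aᶜ + (cutSum c B + cutSum c Bᶜ) := by
    simp only [cutSum_eq_sum_ite, ← Finset.sum_add_distrib]
    refine Finset.sum_le_sum fun u _ => Finset.sum_le_sum fun v _ => ?_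
    have := h0 u v
    by_cases h1 : u ∈ A <;> by_cases h2 : u ∈ B <;> by_cases h3 : v ∈ A <;> by_cases h4 : v ∈ B <;>
      simp [Finset.mem_symmDiff, h1, h2, h3, h4, this]
  simp only [cutSum_compl hc] at h
  linarith

open scoped Classical in
/-- Any two vertices of a uniform tree are separated by a set that is a side of an edge. -/
theorem exists_cutValue_le {V : Type*} [Fintype V] {T : CapGraph V} (hT : T.graph.IsTree) {a : ℝ}
    (hcap : ∀ u v, T.graph.Adj u v → T.cap u v = a) {x y : V} (hxy : x ≠ y) :
    ∃ S : Finset V, x ∈ S ∧ y ∉ S ∧ T.cutValue S ≤ a := by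
  obtain ⟨p, hp⟩ := (hT.existsUnique_path x y).exists
  cases p with
  | nil => exact absurd rfl hxy
  | @cons _ b _ h q =>
    rw [SimpleGraph.Walk.cons_isPath_iff] at hp
    -- The first edge `xb` of the path is a bridge; the component of `x` without it is the set
    -- sought, and `xb` is its only boundary edge.
    set G' := T.graph.deleteEdges {s(x, b)} with hG'
    have hbr : ¬ G'.Reachable x b := by
      have := SimpleGraph.isAcyclic_iff_forall_adj_isBridge.1 hT.isAcyclic h
      rwa [SimpleGraph.isBridge_iff] at this
    have hby : G'.Reachable b y := by
      refine ⟨q.toDeleteEdges {s(x, b)} fun e he hex => ?_⟩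
      rw [Set.mem_singleton_iff] at hex
      subst hex
      exact hp.2 (q.fst_mem_support_of_mem_edges he)
    refine ⟨Finset.univ.filter (G'.Reachable x), by simp, ?_, ?_⟩
    · simp only [Finset.mem_filter, Finset.mem_univ, true_and]
      exact fun hxy' => hbr (hxy'.trans hby.symm)
    · have key : ∀ u v, G'.Reachable x u → ¬ G'.Reachable x v → T.graph.Adj u v →
          u = x ∧ v = b := by
        intro u v hu hv huv
        by_contra hne
        refine hv (hu.trans (SimpleGraph.Adj.reachable ?_))
        rw [hG', SimpleGraph.deleteEdges_adj]
        refine ⟨huv, fun h' => ?_⟩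
        rcases Sym2.eq_iff.1 h' with h' | ⟨rfl, rfl⟩
        · exact hne h'
        · exact hbr hu
      unfold cutValue
      rw [Finset.sum_eq_single_of_mem x (by simp), Finset.sum_eq_single_of_mem b (by simpa using hbr)]
      · exact (hcap _ _ h).le
      · intro v hv hvb
        refine T.cap_eq_zero _ _ fun hadj => hvb (key x v (.refl _) (by simpa using hv) hadj).2
      · intro u hu hux
        refine Finset.sum_eq_zero fun v hv => T.cap_eq_zero _ _ fun hadj => hux ?_
        exact (key u v (by simpa using hu) (by simpa using hv) hadj).1

open scoped Classical in
/-- In a uniform 3-regular tree, a set of inner vertices whose boundary has at most two edges is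
empty. -/
theorem eq_empty_of_cutValue_le {V : Type*} [Fintype V] {T : CapGraph V} (hT : T.graph.IsTree)
    {a : ℝ} (ha : 0 < a) (hcap : ∀ u v, T.graph.Adj u v → T.cap u v = a) {D : Finset V}
    (hdeg : ∀ v ∈ D, T.graph.degree v = 3) (hcut : T.cutValue D ≤ 2 * a) : D = ∅ := by
  by_contra hD
  -- The degrees in `D` sum to `3 * D.card`, and at most `2 * D.card - 2` of this stays inside `D`.
  -- At least `D.card + 2` edges leave `D`.
  have h1 := hT.sum_card_adj_add_two_le D (Finset.nonempty_iff_ne_empty.2 hD)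
  have h2 : T.cutValue D = (∑ v ∈ D, (Dᶜ.filter (T.graph.Adj v)).card : ℕ) * a := by
    unfold cutValue
    rw [Nat.cast_sum, Finset.sum_mul]
    refine Finset.sum_congr rfl fun v _ => ?_
    rw [← nsmul_eq_mul, ← Finset.sum_const, Finset.sum_filter]
    refine Finset.sum_congr rfl fun w _ => ?_
    split_ifs with h
    · exact hcap _ _ h
    · exact T.cap_eq_zero _ _ h
  have h3 : ∑ v ∈ D, ((D.filter (T.graph.Adj v)).card + (Dᶜ.filter (T.graph.Adj v)).card)
      = ∑ v ∈ D, 3 := by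
    refine Finset.sum_congr rfl fun v hv => ?_
    rw [← hdeg v hv, ← SimpleGraph.card_neighborFinset_eq_degree, ← Finset.card_union_of_disjoint,
      ← Finset.filter_union, Finset.union_compl]
    · congr 1; ext; simp
    · exact Finset.disjoint_filter_filter disjoint_compl_right
  rw [Finset.sum_add_distrib, Finset.sum_const, smul_eq_mul] at h3
  rw [h2] at hcut
  have h4 : ((∑ v ∈ D, (Dᶜ.filter (T.graph.Adj v)).card : ℕ) : ℝ) ≤ 2 :=
    le_of_mul_le_mul_right hcut ha
  norm_cast at h4
  have := Finset.card_pos.2 (Finset.nonempty_iff_ne_empty.2 hD)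
  omega

open scoped Classical in
/-- A contraction-based mimicking network of a uniform 3-regular tree merges no vertices. -/
theorem IsUniformCubicTree.injective {V W : Type*} [Fintype V] [Fintype W] {T : CapGraph V}
    {K : Finset V} (h : T.IsUniformCubicTree K) {H : CapGraph W} {ι : K ↪ W} {f : V → W}
    (hι : ∀ t : K, f t = ι t) (hf : T.IsContractionMap H f) (hmim : T.IsMimicking K H ι) :
    Function.Injective f := by
  obtain ⟨hT, hdeg, ⟨a, ha, hcap⟩, hK⟩ := h
  intro x y hfxy
  by_contra hxy
  obtain ⟨S, hxS, hyS, hS⟩ := exists_cutValue_le hT hcap hxy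
  set U : Set K := {t | (t : V) ∈ S} with hU
  -- The preimage of `B` is a union of fibres that contains the same terminals as `S` and whose cut
  -- value is also at most `a`.
  obtain ⟨B, hB, hBe⟩ := (H.minCut_isLeast ι U).1
  have hle : H.cutValue B ≤ a := by
    rw [← hBe, hmim U]
    exact ((T.minCut_isLeast _ U).2 ⟨S, fun t => Iff.rfl, rfl⟩).trans hS
  rw [hf.cutValue_eq] at hle
  set A : Finset V := Finset.univ.filter (f · ∈ B) with hA
  have hAS : symmDiff A S = ∅ := by
    refine eq_empty_of_cutValue_le hT ha hcap (fun v hv => (hdeg v).resolve_left fun h1 => ?_)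
      ((cutSum_symmDiff_le T.cap_symm T.cap_nonneg A S).trans ?_)
    · have h2 : v ∈ A ↔ v ∈ S := by
        have := hB ⟨v, (hK v).2 h1⟩
        rw [← hι] at this
        simpa [hA, hU] using this
      rw [Finset.mem_symmDiff] at hv
      tauto
    · change T.cutValue A + T.cutValue S ≤ _
      linarith
  have hAS' : A = S := symmDiff_eq_bot.1 hAS
  refine hyS ?_
  rw [← hAS'] at hxS ⊢
  simpa [hA, ← hfxy] using hxS

/-! ### Caterpillars as uniform cubic trees -/

/-- The parent function of a caterpillar on the natural numbers. -/
def caterpillarParent (j : ℕ) : ℕ := if j % 2 = 0 then j - 1 else j - 2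

/-- The caterpillar on `n` vertices with unit capacities. -/
noncomputable def caterpillar (n : ℕ) : CapGraph (ULift.{u} (Fin n)) where
  graph :=
    { Adj := fun x y => x ≠ y ∧
        ((x.down : ℕ) = caterpillarParent y.down ∨ (y.down : ℕ) = caterpillarParent x.down)
      symm := ⟨fun _ _ h => ⟨h.1.symm, h.2.symm⟩⟩
      loopless := ⟨fun _ h => h.1 rfl⟩ }
  cap x y := open scoped Classical in if x ≠ y ∧
    ((x.down : ℕ) = caterpillarParent y.down ∨ (y.down : ℕ) = caterpillarParent x.down) then 1 else 0
  cap_symm x y := by simp only [ne_comm, or_comm]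
  cap_nonneg x y := by split_ifs <;> norm_num
  cap_eq_zero x y h := if_neg h

theorem caterpillar_connected (n : ℕ) : (caterpillar.{u} (n + 1)).graph.Connected := by
  have key : ∀ i (hi : i < n + 1), (caterpillar.{u} (n + 1)).graph.Reachable ⟨⟨i, hi⟩⟩ ⟨0⟩ := by
    intro i
    induction i using Nat.strong_induction_on with
    | _ i ih =>
      intro hi
      rcases Nat.eq_zero_or_pos i with rfl | hpos
      · exact .refl _
      · have hlt : caterpillarParent i < i := by unfold caterpillarParent; split_ifs <;> omega
        refine SimpleGraph.Reachable.trans ?_ (ih _ hlt (hlt.trans hi))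
        refine SimpleGraph.Adj.reachable ⟨fun h => ?_, Or.inr rfl⟩
        simp only [ULift.up.injEq, Fin.mk.injEq] at h
        omega
  exact SimpleGraph.Connected.mk fun x y => (key _ x.down.2).trans (key _ y.down.2).symm

theorem caterpillar_isTree (n : ℕ) : (caterpillar.{u} (n + 1)).graph.IsTree := by
  classical
  have hconn := caterpillar_connected.{u} n
  rw [SimpleGraph.isTree_iff_connected_and_card]
  refine ⟨hconn, le_antisymm ?_ hconn.card_vert_le_card_edgeSet_add_one⟩
  rw [Nat.card_eq_fintype_card, Nat.card_eq_fintype_card, ← SimpleGraph.edgeFinset_card]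
  have hp : ∀ i : Fin (n + 1), caterpillarParent i < n + 1 := fun i => by
    unfold caterpillarParent; split_ifs <;> omega
  have hsub : (caterpillar.{u} (n + 1)).graph.edgeFinset ⊆
      (Finset.univ.erase ⟨0⟩).image fun x => s(x, ⟨⟨caterpillarParent x.down, hp _⟩⟩) := by
    intro e he
    induction e with
    | _ x y =>
    rw [SimpleGraph.mem_edgeFinset, SimpleGraph.mem_edgeSet] at he
    obtain ⟨hne, h⟩ := he
    have h0 : ∀ z w : ULift.{u} (Fin (n + 1)), z ≠ w → (w.down : ℕ) = caterpillarParent z.down →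
        z ≠ ⟨0⟩ ∧ w = ⟨⟨caterpillarParent z.down, hp _⟩⟩ := by
      rintro ⟨z⟩ ⟨w⟩ hzw h
      refine ⟨?_, by ext; exact h⟩
      intro hz
      rw [ULift.up.injEq] at hz
      subst hz
      exact hzw (by ext; simpa [caterpillarParent] using h.symm)
    rw [Finset.mem_image]
    rcases h with h | h
    · obtain ⟨h1, h2⟩ := h0 y x hne.symm h
      exact ⟨y, by simpa using h1, by rw [← h2, Sym2.eq_swap]⟩
    · obtain ⟨h1, h2⟩ := h0 x y hne h
      exact ⟨x, by simpa using h1, by rw [← h2]⟩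
  have h1 := (Finset.card_le_card hsub).trans Finset.card_image_le
  rw [Finset.card_erase_of_mem (by simp)] at h1
  simp only [Finset.card_univ, Fintype.card_ulift, Fintype.card_fin] at h1 ⊢
  omega

open scoped Classical in
-- The odd numbers form a spine hanging from `0`. For `r < m` the neighbours of `2r + 1` are `2r +
-- 2`, `2r + 3` and its parent, which truncated subtraction makes `0` when `r = 0`. The even numbers
-- and `2m + 1` are leaves; the even number of vertices ensures that no spine vertex has degree two.
theorem caterpillar_degree (m : ℕ) (v : ULift.{u} (Fin (2 * m + 2))) :
    (caterpillar.{u} (2 * m + 2)).graph.degree v = 1 ∨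
      (caterpillar.{u} (2 * m + 2)).graph.degree v = 3 := by
  obtain ⟨⟨i, hi⟩⟩ := v
  have hcard : (caterpillar.{u} (2 * m + 2)).graph.degree ⟨⟨i, hi⟩⟩
      = ((Finset.range (2 * m + 2)).filter fun j => i ≠ j ∧
        (i = caterpillarParent j ∨ j = caterpillarParent i)).card := by
    rw [← SimpleGraph.card_neighborFinset_eq_degree,
      ← Finset.card_image_of_injective (f := fun x : ULift.{u} (Fin (2 * m + 2)) => (x.down : ℕ)) _
        fun x y h => ULift.ext _ _ (Fin.ext h)]
    congr 1
    ext j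
    simp only [Finset.mem_image, SimpleGraph.mem_neighborFinset, Finset.mem_filter,
      Finset.mem_range]
    constructor
    · rintro ⟨⟨j⟩, ⟨hne, h⟩, rfl⟩
      exact ⟨j.2, fun h' => hne (ULift.ext _ _ (Fin.ext h')), h⟩
    · rintro ⟨hj, hne, h⟩
      refine ⟨⟨⟨j, hj⟩⟩, ⟨fun h' => hne ?_, h⟩, rfl⟩
      simpa using h'
  rw [hcard]
  have hset : ∀ s : Finset ℕ, (∀ j, j ∈ s ↔ j < 2 * m + 2 ∧ i ≠ j ∧
      (i = caterpillarParent j ∨ j = caterpillarParent i)) →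
      (Finset.range (2 * m + 2)).filter (fun j => i ≠ j ∧
        (i = caterpillarParent j ∨ j = caterpillarParent i)) = s := by
    intro s hs
    ext j
    rw [hs]
    simp
  rcases Nat.even_or_odd' i with ⟨r, rfl | rfl⟩
  · left
    rcases Nat.eq_zero_or_pos r with rfl | hr
    · rw [hset {1}, Finset.card_singleton]
      intro j
      simp only [Finset.mem_singleton, caterpillarParent]
      split_ifs <;> omega
    · rw [hset {2 * r - 1}, Finset.card_singleton]
      intro j
      simp only [Finset.mem_singleton, caterpillarParent]
      split_ifs <;> omega
  · rcases Nat.lt_or_ge r m with hr | hr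
    · right
      rw [hset {2 * r + 1 - 2, 2 * r + 2, 2 * r + 3}, Finset.card_eq_three]
      · exact ⟨_, _, _, by omega, by omega, by omega, rfl⟩
      · intro j
        simp only [Finset.mem_insert, Finset.mem_singleton, caterpillarParent]
        split_ifs <;> omega
    · left
      rw [hset {2 * r + 1 - 2}, Finset.card_singleton]
      intro j
      simp only [Finset.mem_singleton, caterpillarParent]
      split_ifs <;> omega

open scoped Classical in
theorem exists_isUniformCubicTree (k : ℕ) (hk : 2 ≤ k) :
    ∃ (V : Type u) (_ : Fintype V) (T : CapGraph V) (K : Finset V),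
      T.IsUniformCubicTree K ∧ K.card = k := by
  obtain ⟨m, rfl⟩ := Nat.exists_eq_add_of_le hk
  have h : (caterpillar.{u} (2 * m + 2)).IsUniformCubicTree
      (Finset.univ.filter fun v => (caterpillar.{u} (2 * m + 2)).graph.degree v = 1) :=
    ⟨caterpillar_isTree _, caterpillar_degree m, ⟨1, one_pos, fun u v huv => if_pos huv⟩,
      fun v => by simp⟩
  refine ⟨_, inferInstance, _, _, h, ?_⟩
  have := h.card_add_two
  rw [Fintype.card_ulift, Fintype.card_fin] at this
  omega

end CapGraph

/-! ### Replacing stars by triangles -/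

namespace SimpleGraph

/-- The graph obtained from `G` by deleting the vertices in `I` and joining any two neighbours of
each deleted vertex. -/
def starClique {V : Type*} (G : SimpleGraph V) (I : Finset V) : SimpleGraph {x // x ∉ I} where
  Adj x y := x ≠ y ∧ (G.Adj x y ∨ ∃ v ∈ I, G.Adj v x ∧ G.Adj v y)
  symm := ⟨fun _ _ h => ⟨h.1.symm, h.2.imp (fun h => h.symm) fun ⟨v, hv, h1, h2⟩ => ⟨v, hv, h2, h1⟩⟩⟩
  loopless := ⟨fun _ h => h.1 rfl⟩

end SimpleGraph

namespace CapGraph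

variable {V : Type*} [Fintype V]

/-- The minimum cut in the star at `v` that separates the end `x` from the other ends. -/
noncomputable def starWeight (T : CapGraph V) (v x : V) : ℝ :=
  min (T.cap v x) (∑ w, T.cap v w - T.cap v x)

open scoped Classical in
/-- The capacities of the triangle that replaces the star at `v`. -/
noncomputable def triangleCap (T : CapGraph V) (v x y : V) : ℝ :=
  if x ≠ y ∧ T.graph.Adj v x ∧ T.graph.Adj v y then
    T.starWeight v x + T.starWeight v y - (∑ w ∈ T.graph.neighborFinset v, T.starWeight v w) / 2
  else 0

open scoped Classical in
theorem sum_cap_eq_sum_neighborFinset (T : CapGraph V) (v : V) :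
    ∑ w, T.cap v w = ∑ w ∈ T.graph.neighborFinset v, T.cap v w := by
  symm
  apply Finset.sum_subset (Finset.subset_univ _)
  intro x _ hx
  apply T.cap_eq_zero
  simpa using hx

open scoped Classical in
theorem triangleCap_symm (T : CapGraph V) (v x y : V) :
    T.triangleCap v x y = T.triangleCap v y x := by
  unfold triangleCap
  exact if_congr ⟨fun h => ⟨h.1.symm, h.2.2, h.2.1⟩, fun h => ⟨h.1.symm, h.2.2, h.2.1⟩⟩
    (by ring) rfl

open scoped Classical in
-- With star weights `s`, the pair `xy` gets `(s x + s y - s z) / 2`, the solution of the equations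
-- that the two triangle edges at each end add up to its star weight. Nonnegativity is the triangle
-- inequality for `s`.
theorem triangleCap_nonneg {T : CapGraph V} {v : V} (hv : T.graph.degree v = 3) (x y : V) :
    0 ≤ T.triangleCap v x y := by
  unfold triangleCap
  split_ifs with h
  · obtain ⟨hxy, hx, hy⟩ := h
    have hy' : y ∈ (T.graph.neighborFinset v).erase x := by simp [hxy.symm, hy]
    have hz : (((T.graph.neighborFinset v).erase x).erase y).card = 1 := by
      rw [Finset.card_erase_of_mem hy', Finset.card_erase_of_mem (by simpa using hx),
        SimpleGraph.card_neighborFinset_eq_degree, hv]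
    obtain ⟨z, hz⟩ := Finset.card_eq_one.1 hz
    have key : ∀ F : V → ℝ, ∑ w ∈ T.graph.neighborFinset v, F w = F x + (F y + F z) := by
      intro F
      rw [← Finset.add_sum_erase _ _ (by simpa using hx : x ∈ T.graph.neighborFinset v),
        ← Finset.add_sum_erase _ _ hy', hz, Finset.sum_singleton]
    rw [key]
    simp only [starWeight, sum_cap_eq_sum_neighborFinset, key]
    have h1 := T.cap_nonneg v x
    have h2 := T.cap_nonneg v y
    have h3 := T.cap_nonneg v z
    have := min_le_left (T.cap v z) (T.cap v x + (T.cap v y + T.cap v z) - T.cap v z)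
    have := min_le_right (T.cap v z) (T.cap v x + (T.cap v y + T.cap v z) - T.cap v z)
    rcases min_choice (T.cap v x) (T.cap v x + (T.cap v y + T.cap v z) - T.cap v x) with e1 | e1 <;>
    rcases min_choice (T.cap v y) (T.cap v x + (T.cap v y + T.cap v z) - T.cap v y) with e2 | e2 <;>
    rw [e1, e2] <;> linarith
  · exact le_rfl

open scoped Classical in
/-- The cut function of the triangle that replaces the star at `v`. -/
theorem cutSum_triangleCap {T : CapGraph V} {v : V} (hv : T.graph.degree v = 3) (A : Finset V) :
    cutSum (T.triangleCap v) A =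
      min (∑ w ∈ T.graph.neighborFinset v with w ∈ A, T.cap v w)
        (∑ w ∈ T.graph.neighborFinset v with w ∉ A, T.cap v w) := by
  have h1 : cutSum (T.triangleCap v) A = ∑ x ∈ T.graph.neighborFinset v with x ∈ A,
      ∑ y ∈ T.graph.neighborFinset v with y ∉ A, (T.starWeight v x + T.starWeight v y -
        (∑ w ∈ T.graph.neighborFinset v, T.starWeight v w) / 2) := by
    have h0 : ∀ x y, x ∉ T.graph.neighborFinset v ∨ y ∉ T.graph.neighborFinset v →
        T.triangleCap v x y = 0 := by
      intro x y h
      simp only [SimpleGraph.mem_neighborFinset] at h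
      exact if_neg (by tauto)
    unfold cutSum
    symm
    refine (Finset.sum_congr rfl fun x hx => ?_).trans (Finset.sum_subset
      (fun x hx => (Finset.mem_filter.1 hx).2) fun x hx hx' => Finset.sum_eq_zero fun y _ =>
        h0 x y (Or.inl fun h => hx' (Finset.mem_filter.2 ⟨h, hx⟩)))
    refine (Finset.sum_congr rfl fun y hy => ?_).trans (Finset.sum_subset
      (fun y hy => Finset.mem_compl.2 (Finset.mem_filter.1 hy).2) fun y hy hy' =>
        h0 x y (Or.inr fun h => hy' (Finset.mem_filter.2 ⟨h, Finset.mem_compl.1 hy⟩)))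
    simp only [Finset.mem_filter, SimpleGraph.mem_neighborFinset] at hx hy
    exact (if_pos ⟨fun h => hy.2 (h ▸ hx.2), hx.1, hy.1⟩).symm
  rw [h1]
  simp only [starWeight, sum_cap_eq_sum_neighborFinset]
  rw [← SimpleGraph.card_neighborFinset_eq_degree] at hv
  obtain ⟨a, b, c, hab, hac, hbc, hN⟩ := Finset.card_eq_three.1 hv
  have hsum : ∀ (p : V → Prop) [DecidablePred p] (F : V → ℝ),
      ∑ w ∈ T.graph.neighborFinset v with p w, F w =
        (if p a then F a else 0) + ((if p b then F b else 0) + if p c then F c else 0) := by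
    intro p _ F
    rw [Finset.sum_filter, hN, Finset.sum_insert (by simp [hab, hac]),
      Finset.sum_insert (by simp [hbc]), Finset.sum_singleton]
  have hsum' : ∀ F : V → ℝ, ∑ w ∈ T.graph.neighborFinset v, F w = F a + (F b + F c) := by
    intro F
    simpa using hsum (fun _ => True) F
  simp only [hsum, hsum']
  have ha := T.cap_nonneg v a
  have hb := T.cap_nonneg v b
  have hc := T.cap_nonneg v c
  generalize T.cap v a = α at *
  generalize T.cap v b = β at *
  generalize T.cap v c = γ at *
  rw [show α + (β + γ) - α = β + γ by ring, show α + (β + γ) - β = α + γ by ring,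
    show α + (β + γ) - γ = α + β by ring]
  -- If `A` contains all or none of the three ends, both sides vanish. Otherwise it separates one
  -- end from the other two, and the value is the star weight of that end.
  by_cases h1 : a ∈ A <;> by_cases h2 : b ∈ A <;> by_cases h3 : c ∈ A <;>
    simp only [h1, h2, h3, not_true, not_false_iff, if_true, if_false, add_zero, zero_add]
  · rw [min_eq_right (by positivity)]
  · rw [min_comm (α + β) γ]; ring
  · rw [min_comm (α + γ) β]; ring
  · ring
  · rw [min_comm (β + γ) α]; ring
  · ring
  · ring
  · rw [min_eq_left (by positivity)]

open scoped Classical in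
/-- The capacities of the star at `v`. -/
noncomputable def starCap (T : CapGraph V) (v x y : V) : ℝ :=
  if x = v ∨ y = v then T.cap x y else 0

open scoped Classical in
theorem cutSum_starCap (T : CapGraph V) (v : V) (A : Finset V) :
    cutSum (T.starCap v) A =
      if v ∈ A then ∑ w ∈ T.graph.neighborFinset v with w ∉ A, T.cap v w
      else ∑ w ∈ T.graph.neighborFinset v with w ∈ A, T.cap v w := by
  have h : ∀ (p : V → Prop) [DecidablePred p], ∑ w with p w, T.cap v w
      = ∑ w ∈ T.graph.neighborFinset v with p w, T.cap v w := by
    intro p _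
    symm
    apply Finset.sum_subset (Finset.filter_subset_filter _ (Finset.subset_univ _))
    intro x hx hx'
    apply T.cap_eq_zero
    simp only [Finset.mem_filter, Finset.mem_univ, true_and, SimpleGraph.mem_neighborFinset] at hx hx'
    tauto
  split_ifs with hv
  · rw [← h]
    unfold cutSum
    rw [Finset.sum_eq_single_of_mem v hv]
    · refine Finset.sum_congr (by ext; simp) fun w _ => if_pos (Or.inl rfl)
    · intro x hx hxv
      refine Finset.sum_eq_zero fun y hy => if_neg ?_
      rw [Finset.mem_compl] at hy
      rintro (rfl | rfl)
      · exact hxv rfl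
      · exact hy hv
  · rw [← h]
    unfold cutSum
    refine Finset.sum_congr (by ext; simp) fun x hx => ?_
    rw [Finset.sum_eq_single_of_mem v (by simpa using hv)]
    · exact (if_pos (Or.inr rfl)).trans (T.cap_symm _ _)
    · intro y hy hyv
      refine if_neg ?_
      rintro (rfl | rfl)
      · simp_all
      · exact hyv rfl

open scoped Classical in
/-- The capacities after the replacement of the stars at the vertices in `I`. -/
noncomputable def starTriangleCap (T : CapGraph V) (I : Finset V) (x y : V) : ℝ :=
  (if x ∉ I ∧ y ∉ I then T.cap x y else 0) + ∑ v ∈ I, T.triangleCap v x y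

open scoped Classical in
-- Independence of `I` means that no edge lies in two stars, so the capacity splits into the stars
-- and the edges avoiding `I`. Each star can then be treated separately.
theorem cap_eq_add_sum_starCap {W : Type*} (T : CapGraph W) {I : Finset W}
    (hI : ∀ v ∈ I, ∀ w ∈ I, ¬ T.graph.Adj v w) (x y : W) :
    T.cap x y = (if x ∉ I ∧ y ∉ I then T.cap x y else 0) + ∑ v ∈ I, T.starCap v x y := by
  by_cases hx : x ∈ I
  · rw [if_neg (by simp [hx]), zero_add, Finset.sum_eq_single_of_mem x hx]
    · exact (if_pos (Or.inl rfl)).symm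
    · intro v hv hvx
      unfold starCap
      split_ifs with h
      · rcases h with rfl | rfl
        · exact absurd rfl hvx
        · exact T.cap_eq_zero _ _ (hI _ hx _ hv)
      · rfl
  · by_cases hy : y ∈ I
    · rw [if_neg (by simp [hy]), zero_add, Finset.sum_eq_single_of_mem y hy]
      · exact (if_pos (Or.inr rfl)).symm
      · intro v hv hvy
        refine if_neg ?_
        rintro (rfl | rfl)
        · exact hx hv
        · exact hvy rfl
    · rw [if_pos ⟨hx, hy⟩, Finset.sum_eq_zero, add_zero]
      intro v hv
      refine if_neg ?_
      rintro (rfl | rfl)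
      · exact hx hv
      · exact hy hv

theorem cutSum_add_sum {ι : Type*} (c : V → V → ℝ) (I : Finset ι) (d : ι → V → V → ℝ)
    (A : Finset V) :
    cutSum (fun x y => c x y + ∑ v ∈ I, d v x y) A = cutSum c A + ∑ v ∈ I, cutSum (d v) A := by
  classical
  unfold cutSum
  simp only [Finset.sum_add_distrib]
  congr 1
  rw [Finset.sum_comm (s := I)]
  exact Finset.sum_congr rfl fun _ _ => Finset.sum_comm

theorem starTriangleCap_eq_zero_of_mem (T : CapGraph V) {I : Finset V}
    (hI : ∀ v ∈ I, ∀ w ∈ I, ¬ T.graph.Adj v w) {x y : V} (h : x ∈ I ∨ y ∈ I) :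
    T.starTriangleCap I x y = 0 := by
  unfold starTriangleCap
  rw [if_neg (by tauto), zero_add]
  refine Finset.sum_eq_zero fun v hv => if_neg fun h' => ?_
  rcases h with h | h
  · exact hI v hv _ h h'.2.1
  · exact hI v hv _ h h'.2.2

open scoped Classical in
/-- The graph that arises from `T` when the stars at the vertices in `I`, all of degree three, are
replaced by triangles. -/
noncomputable def starTriangle (T : CapGraph V) (I : Finset V)
    (hdeg : ∀ v ∈ I, T.graph.degree v = 3) : CapGraph {x // x ∉ I} where
  graph := T.graph.starClique I
  cap x y := T.starTriangleCap I x y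
  cap_symm x y := by
    simp only [starTriangleCap, T.cap_symm x y, T.triangleCap_symm _ (x : V) y, and_comm]
  cap_nonneg x y := by
    refine add_nonneg ?_ (Finset.sum_nonneg fun v hv => triangleCap_nonneg (hdeg v hv) _ _)
    split_ifs
    · exact T.cap_nonneg _ _
    · exact le_rfl
  cap_eq_zero x y h := by
    by_cases hxy : x = y
    · subst hxy
      have h1 : T.cap x x = 0 := T.cap_eq_zero _ _ (T.graph.irrefl)
      simp [starTriangleCap, triangleCap, h1]
    · have h' : ¬ (T.graph.Adj x y ∨ ∃ v ∈ I, T.graph.Adj v x ∧ T.graph.Adj v y) :=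
        fun h' => h ⟨hxy, h'⟩
      push Not at h'
      unfold starTriangleCap
      rw [T.cap_eq_zero _ _ h'.1, ite_self, zero_add]
      exact Finset.sum_eq_zero fun v hv => if_neg fun h2 => h'.2 v hv h2.2.1 h2.2.2

open scoped Classical in
theorem cutValue_starTriangle (T : CapGraph V) {I : Finset V}
    (hI : ∀ v ∈ I, ∀ w ∈ I, ¬ T.graph.Adj v w) (hdeg : ∀ v ∈ I, T.graph.degree v = 3)
    {A : Finset V} {B : Finset {x // x ∉ I}} (hAB : ∀ x, x ∈ B ↔ (x : V) ∈ A) :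
    (T.starTriangle I hdeg).cutValue B = cutSum (T.starTriangleCap I) A := by
  have h : ∀ F : V → ℝ, (∀ x ∈ I, F x = 0) → ∑ x, F x = ∑ x : {x // x ∉ I}, F x := by
    intro F hF
    rw [← Finset.sum_subtype Iᶜ (by simp) F]
    symm
    exact Finset.sum_subset (Finset.subset_univ _) fun x _ hx => hF x (by simpa using hx)
  change cutSum _ _ = _
  rw [cutSum_eq_sum_ite, cutSum_eq_sum_ite, h]
  · refine Finset.sum_congr rfl fun x _ => ?_
    rw [h]
    · refine Finset.sum_congr rfl fun y _ => ?_
      simp only [hAB]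
      rfl
    · intro y hy
      rw [T.starTriangleCap_eq_zero_of_mem hI (Or.inr hy), ite_self]
  · intro x hx
    refine Finset.sum_eq_zero fun y _ => ?_
    rw [T.starTriangleCap_eq_zero_of_mem hI (Or.inl hx), ite_self]

open scoped Classical in
/-- Replacing stars by triangles keeps the minimum terminal cuts. -/
theorem minCut_starTriangle {κ : Type*} (T : CapGraph V) {I : Finset V}
    (hI : ∀ v ∈ I, ∀ w ∈ I, ¬ T.graph.Adj v w) (hdeg : ∀ v ∈ I, T.graph.degree v = 3)
    {τ : κ ↪ V} {ι : κ ↪ {x // x ∉ I}} (hι : ∀ t, (ι t : V) = τ t) (U : Set κ) :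
    (T.starTriangle I hdeg).minCut ι U = T.minCut τ U := by
  have hT : ∀ A, T.cutValue A = cutSum (fun x y => if x ∉ I ∧ y ∉ I then T.cap x y else 0) A
      + ∑ v ∈ I, cutSum (T.starCap v) A := by
    intro A
    rw [← cutSum_add_sum]
    simp only [← T.cap_eq_add_sum_starCap hI]
    rfl
  have hH : ∀ A, cutSum (T.starTriangleCap I) A =
      cutSum (fun x y => if x ∉ I ∧ y ∉ I then T.cap x y else 0) A
      + ∑ v ∈ I, cutSum (T.triangleCap v) A := fun A => cutSum_add_sum _ _ _ _
  refine le_antisymm (minCut_le_minCut fun A hA => ?_) (minCut_le_minCut fun B hB => ?_)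
  · refine ⟨Finset.univ.filter fun x => (x : V) ∈ A, fun t => by simp [hι, hA], ?_⟩
    rw [T.cutValue_starTriangle hI hdeg (A := A) (by simp), hT, hH]
    gcongr with v hv
    rw [cutSum_triangleCap (hdeg v hv), cutSum_starCap]
    split_ifs
    · exact min_le_right _ _
    · exact min_le_left _ _
  · set A : Finset V := Finset.univ.filter fun x =>
      if h : x ∈ I then
        ∑ w ∈ T.graph.neighborFinset x with w ∉ B.map (Function.Embedding.subtype _), T.cap x w
          ≤ ∑ w ∈ T.graph.neighborFinset x with w ∈ B.map (Function.Embedding.subtype _), T.cap x w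
      else (⟨x, h⟩ : {x // x ∉ I}) ∈ B with hA
    have hAB : ∀ x : {x // x ∉ I}, (x : V) ∈ A ↔ x ∈ B := by
      intro x
      simp [hA, x.2]
    have hAB' : ∀ x, x ∉ I → (x ∈ B.map (Function.Embedding.subtype _) ↔ x ∈ A) := by
      intro x hx
      rw [hAB ⟨x, hx⟩]
      simp [hx]
    have hAI : ∀ v ∈ I, (v ∈ A ↔ ∑ w ∈ T.graph.neighborFinset v with w ∉ A, T.cap v w
        ≤ ∑ w ∈ T.graph.neighborFinset v with w ∈ A, T.cap v w) := by
      intro v hv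
      have hN : ∀ w ∈ T.graph.neighborFinset v,
          (w ∈ B.map (Function.Embedding.subtype _) ↔ w ∈ A) := fun w hw =>
        hAB' w fun hwI => hI v hv w hwI (by simpa using hw)
      rw [← Finset.filter_congr hN, ← Finset.filter_congr fun w hw => not_congr (hN w hw)]
      simp only [hA, Finset.mem_filter, Finset.mem_univ, true_and, dif_pos hv]
    refine ⟨A, fun t => by rw [← hι, hAB, hB], ?_⟩
    rw [T.cutValue_starTriangle hI hdeg (A := A) fun x => (hAB x).symm, hT, hH]
    gcongr with v hv
    rw [cutSum_triangleCap (hdeg v hv), cutSum_starCap]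
    by_cases h : v ∈ A
    · rw [if_pos h, min_eq_right ((hAI v hv).1 h)]
    · rw [if_neg h, min_eq_left (le_of_lt (not_le.1 fun h' => h ((hAI v hv).2 h')))]

end CapGraph

/-! ### Vertex orders without crossing edges -/

/-- The real numbers assigned to the vertices are such that no two edges cross when the vertices
are placed in this order on a convex curve: no edge `cd` separates the ends of an edge `ab`. -/
def IsNonCrossing {W : Type*} (G : SimpleGraph W) (x : W → ℝ) : Prop :=
  ∀ a b c d, G.Adj a b → G.Adj c d →
    0 ≤ (x a - x c) * (x a - x d) * ((x b - x c) * (x b - x d))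

/-- Leaves room to insert a new vertex immediately to the right of its neighbour at `q`. -/
theorem exists_gt_forall_lt (F : Finset ℝ) (q : ℝ) : ∃ y > q, ∀ s ∈ F, q < s → y < s := by
  have h1 : ∀ᶠ y in nhdsWithin q (Set.Ioi q), ∀ s ∈ F, q < s → y < s := by
    rw [Filter.eventually_all_finset]
    intro s _
    by_cases hs : q < s
    · filter_upwards [nhdsWithin_le_nhds (Iio_mem_nhds hs)] with y hy _ using hy
    · exact Filter.Eventually.of_forall fun y h => absurd h hs
  obtain ⟨y, hy, hy'⟩ := (h1.and self_mem_nhdsWithin).exists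
  exact ⟨y, hy', hy⟩

/-- The vertices of a tree have an order in which no two edges cross. -/
theorem SimpleGraph.IsTree.exists_isNonCrossing {V : Type*} [Fintype V] {G : SimpleGraph V}
    (hG : G.IsTree) : ∃ x : V → ℝ, Function.Injective x ∧ IsNonCrossing G x := by
  classical
  have key : ∀ (n : ℕ) (S : Finset V), S.card = n → ∃ x : V → ℝ, Set.InjOn x S ∧
      ∀ a ∈ S, ∀ b ∈ S, ∀ c ∈ S, ∀ d ∈ S, G.Adj a b → G.Adj c d →
        0 ≤ (x a - x c) * (x a - x d) * ((x b - x c) * (x b - x d)) := by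
    intro n
    induction n with
    | zero =>
      intro S hS
      rw [Finset.card_eq_zero] at hS
      subst hS
      exact ⟨0, by simp, by simp⟩
    | succ n ih =>
      intro S hS
      obtain ⟨v, hv, hle⟩ := hG.exists_card_adj_le_one (S := S) (Finset.card_pos.1 (by omega))
      obtain ⟨x, hinj, hx⟩ := ih (S.erase v) (by rw [Finset.card_erase_of_mem hv]; omega)
      -- The position of the only neighbour of `v` in `S`; an arbitrary 0 if there is none.
      obtain ⟨q, hq⟩ : ∃ q : ℝ, ∀ p ∈ S, G.Adj v p → x p = q := by
        rcases (S.filter (G.Adj v)).eq_empty_or_nonempty with he | ⟨p, hp⟩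
        · refine ⟨0, fun p hp hvp => ?_⟩
          have : p ∈ S.filter (G.Adj v) := by simp [hp, hvp]
          simp [he] at this
        · refine ⟨x p, fun p' hp' hvp' => ?_⟩
          rw [Finset.card_le_one.1 hle p hp p' (by simp [hp', hvp'])]
      obtain ⟨y, hy, hy'⟩ := exists_gt_forall_lt ((S.erase v).image x) q
      have hxv : ∀ s, s ≠ v → Function.update x v y s = x s := fun s hs =>
        Function.update_of_ne hs _ _
      have hvv : Function.update x v y v = y := Function.update_self _ _ _
      generalize Function.update x v y = x' at hxv hvv
      have hS' : ∀ s ∈ S, s ≠ v → x s ≤ q ∨ y < x s := by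
        intro s hs hsv
        rcases le_or_gt (x s) q with h | h
        · exact Or.inl h
        · exact Or.inr (hy' _ (Finset.mem_image_of_mem x (Finset.mem_erase.2 ⟨hsv, hs⟩)) h)
      have hne : ∀ s ∈ S, s ≠ v → x s ≠ y := by
        intro s hs hsv h
        rcases hS' s hs hsv with h' | h' <;> linarith
      -- No vertex lies strictly between `q` and the new position `y`, so no edge can separate `v`
      -- from its neighbour.
      have hsgn : ∀ s ∈ S, 0 ≤ (q - x' s) * (y - x' s) := by
        intro s hs
        by_cases hsv : s = v
        · subst hsv; simp [hvv]
        · rw [hxv s hsv]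
          rcases hS' s hs hsv with h | h
          · exact mul_nonneg (by linarith) (by linarith)
          · exact mul_nonneg_of_nonpos_of_nonpos (by linarith) (by linarith)
      have hedge : ∀ p ∈ S, ∀ c ∈ S, ∀ d ∈ S, G.Adj v p →
          0 ≤ (x' v - x' c) * (x' v - x' d) * ((x' p - x' c) * (x' p - x' d)) := by
        intro p hp c hc d hd hvp
        rw [hvv, hxv p hvp.ne', hq p hp hvp]
        have := mul_nonneg (hsgn c hc) (hsgn d hd)
        linarith
      refine ⟨x', ?_, ?_⟩
      · intro s hs t ht hst
        by_cases hsv : s = v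
        · by_cases htv : t = v
          · rw [hsv, htv]
          · rw [hsv, hvv, hxv t htv] at hst
            exact absurd hst.symm (hne t ht htv)
        · by_cases htv : t = v
          · rw [htv, hvv, hxv s hsv] at hst
            exact absurd hst (hne s hs hsv)
          · rw [hxv s hsv, hxv t htv] at hst
            exact hinj (by simp [hsv, Finset.mem_coe.1 hs]) (by simp [htv, Finset.mem_coe.1 ht]) hst
      · intro a ha b hb c hc d hd hab hcd
        by_cases hav : a = v
        · subst hav; exact hedge b hb c hc d hd hab
        by_cases hbv : b = v
        · subst hbv; linarith [hedge a ha c hc d hd hab.symm]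
        by_cases hcv : c = v
        · subst hcv; linarith [hedge d hd a ha b hb hcd]
        by_cases hdv : d = v
        · subst hdv; linarith [hedge c hc a ha b hb hcd.symm]
        rw [hxv a hav, hxv b hbv, hxv c hcv, hxv d hdv]
        exact hx a (by simp [*]) b (by simp [*]) c (by simp [*]) d (by simp [*]) hab hcd
  obtain ⟨x, hinj, hx⟩ := key _ Finset.univ rfl
  exact ⟨x, by simpa using hinj, fun a b c d => hx a (by simp) b (by simp) c (by simp) d (by simp)⟩

/-- A chord that separates `p` and `q` and avoids `v` separates `v` from `p` or from `q`. -/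
theorem mul_neg_or_mul_neg {p q v : ℝ} (h : p * q < 0) (hv : v ≠ 0) : p * v < 0 ∨ v * q < 0 := by
  rcases lt_or_gt_of_ne hv with hv | hv <;> rcases mul_neg_iff.1 h with h | h
  · exact Or.inl (mul_neg_of_pos_of_neg h.1 hv)
  · exact Or.inr (mul_neg_of_neg_of_pos hv h.2)
  · exact Or.inr (mul_neg_of_pos_of_neg hv h.2)
  · exact Or.inl (mul_neg_of_neg_of_pos h.1 hv)

open scoped Classical in
/-- Replacing stars of degree three by triangles creates no crossings. -/
theorem IsNonCrossing.starClique {V : Type*} [Fintype V] {G : SimpleGraph V} {x : V → ℝ}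
    (hx : IsNonCrossing G x) (hinj : Function.Injective x) {I : Finset V}
    (hdeg : ∀ v ∈ I, G.degree v = 3) :
    IsNonCrossing (G.starClique I) (fun v => x v) := by
  have hne : ∀ {v c d : V}, c ≠ v → d ≠ v → (x v - x c) * (x v - x d) ≠ 0 := fun hc hd =>
    mul_ne_zero (sub_ne_zero.2 fun h => hc (hinj h).symm) (sub_ne_zero.2 fun h => hd (hinj h).symm)
  have key : ∀ a b c d v, G.Adj v a → G.Adj v b → G.Adj c d → c ≠ v → d ≠ v →
      0 ≤ (x a - x c) * (x a - x d) * ((x b - x c) * (x b - x d)) := by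
    intro a b c d v ha hb hcd hc hd
    by_contra h
    rcases mul_neg_or_mul_neg (not_le.1 h) (hne hc hd) with h | h
    · exact absurd (hx a v c d ha.symm hcd) (not_le.2 h)
    · exact absurd (hx v b c d hb hcd) (not_le.2 h)
  rintro ⟨a, ha⟩ ⟨b, hb⟩ ⟨c, hc⟩ ⟨d, hd⟩ ⟨hab, h1⟩ ⟨hcd, h2⟩
  simp only [ne_eq, Subtype.mk.injEq] at hab hcd h1 h2 ⊢
  have hI : ∀ {y v : V}, y ∉ I → v ∈ I → y ≠ v := fun hy hv h => hy (h ▸ hv)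
  rcases h1 with h1 | ⟨v, hv, hva, hvb⟩ <;> rcases h2 with h2 | ⟨w, hw, hwc, hwd⟩
  · exact hx a b c d h1 h2
  · linarith [key c d a b w hwc hwd h1 (hI ha hw) (hI hb hw)]
  · exact key a b c d v hva hvb h2 (hI hc hv) (hI hd hv)
  · by_contra h
    -- Crossing edges of one triangle would need four distinct neighbours of `v`. For different
    -- centres, the edge `cd` would separate the ends of `va` or of `vb`, so a tree edge would cross
    -- a triangle edge, which `key` excludes.
    by_cases hvw : v = w
    · subst hvw
      have hac : a ≠ c := by rintro rfl; simp at h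
      have had : a ≠ d := by rintro rfl; simp at h
      have hbc : b ≠ c := by rintro rfl; simp at h
      have hbd : b ≠ d := by rintro rfl; simp at h
      have hcard : ({a, b, c, d} : Finset V).card = 4 := by
        rw [Finset.card_insert_of_notMem (by simp [*]), Finset.card_insert_of_notMem (by simp [*]),
          Finset.card_insert_of_notMem (by simp [*]), Finset.card_singleton]
      have hsub : ({a, b, c, d} : Finset V) ⊆ G.neighborFinset v := by
        intro y hy
        simp only [Finset.mem_insert, Finset.mem_singleton] at hy
        rw [SimpleGraph.mem_neighborFinset]
        rcases hy with rfl | rfl | rfl | rfl <;> assumption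
      have := Finset.card_le_card hsub
      rw [hcard, SimpleGraph.card_neighborFinset_eq_degree, hdeg v hv] at this
      omega
    · rcases mul_neg_or_mul_neg (not_le.1 h) (hne (hI hc hv) (hI hd hv)) with h | h
      · linarith [key c d a v w hwc hwd hva.symm (hI ha hw) hvw]
      · linarith [key c d v b w hwc hwd hvb hvw (hI hb hw)]

/-! ### Drawing with vertices on a parabola -/

/-- The point of the standard parabola above `t`. -/
def parabolaPoint (t : ℝ) : ℝ × ℝ := (t, t ^ 2)

theorem parabolaPoint_injective : Function.Injective parabolaPoint := fun _ _ h =>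
  congrArg Prod.fst h

/-- Height above the parabola turns incidences into algebra: a vertex on a chord is a zero of the
product, and at a common point of two chords the products agree. -/
theorem snd_sub_sq_of_mem_segment {a b : ℝ} {z : ℝ × ℝ}
    (hz : z ∈ segment ℝ (parabolaPoint a) (parabolaPoint b)) :
    z.2 - z.1 ^ 2 = (z.1 - a) * (b - z.1) ∧ 0 ≤ (z.1 - a) * (b - z.1) := by
  obtain ⟨s, t, hs, ht, hst, rfl⟩ := hz
  obtain rfl : s = 1 - t := by linarith
  simp only [parabolaPoint, Prod.smul_mk, smul_eq_mul, Prod.mk_add_mk]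
  refine ⟨by ring, ?_⟩
  have : ((1 - t) * a + t * b - a) * (b - ((1 - t) * a + t * b)) = t * (1 - t) * (b - a) ^ 2 := by
    ring
  rw [this]
  positivity

/-- The chord of the parabola that represents an edge. -/
def chord {W : Type*} (x : W → ℝ) (e : Sym2 W) : Set (ℝ × ℝ) :=
  {z | ∃ u v, e = s(u, v) ∧ z ∈ segment ℝ (parabolaPoint (x u)) (parabolaPoint (x v))}

theorem chord_mk {W : Type*} (x : W → ℝ) (u v : W) :
    chord x s(u, v) = segment ℝ (parabolaPoint (x u)) (parabolaPoint (x v)) := by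
  ext z
  constructor
  · rintro ⟨u', v', h, hz⟩
    rcases Sym2.eq_iff.1 h with ⟨rfl, rfl⟩ | ⟨rfl, rfl⟩
    · exact hz
    · rwa [segment_symm]
  · exact fun hz => ⟨u, v, rfl, hz⟩

theorem isPlaneArc_segment {p q : ℝ × ℝ} (h : p ≠ q) : IsPlaneArc p q (segment ℝ p q) := by
  refine ⟨AffineMap.lineMap p q, AffineMap.lineMap_continuous.continuousOn,
    (AffineMap.lineMap_injective ℝ h).injOn, by simp, by simp, ?_⟩
  rw [segment_eq_image_lineMap]

/-- The straight-line drawing of a graph with vertices on a parabola. -/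
def IsNonCrossing.drawing {W : Type*} {G : SimpleGraph W} {x : W → ℝ} (hx : IsNonCrossing G x)
    (hinj : Function.Injective x) : PlaneDrawing G where
  pos w := parabolaPoint (x w)
  arc := chord x
  pos_injective := parabolaPoint_injective.comp hinj
  isArc u v h := by
    rw [chord_mk]
    exact isPlaneArc_segment fun h' => h.ne (hinj (parabolaPoint_injective h'))
  vertex_on_arc e _ w hw := by
    obtain ⟨u, v, rfl, hz⟩ := hw
    have h := (snd_sub_sq_of_mem_segment hz).1
    simp only [parabolaPoint, sub_self] at h
    rcases mul_eq_zero.1 h.symm with h | h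
    · rw [hinj (sub_eq_zero.1 h)]; exact Sym2.mem_mk_left _ _
    · rw [← hinj (sub_eq_zero.1 h)]; exact Sym2.mem_mk_right _ _
  arc_inter e he e' he' hne z hz := by
    obtain ⟨⟨a, b, rfl, hab⟩, ⟨c, d, rfl, hcd⟩⟩ := hz
    have hnc := hx a b c d he he'
    obtain ⟨h1, h0⟩ := snd_sub_sq_of_mem_segment hab
    obtain ⟨h2, -⟩ := snd_sub_sq_of_mem_segment hcd
    have hh : (z.1 - x a) * (x b - z.1) = 0 := by
      by_contra hpos
      replace hpos := lt_of_le_of_ne h0 (Ne.symm hpos)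
      have e1 : (z.1 - x a) * (x b - z.1) = (z.1 - x c) * (x d - z.1) := by linarith
      -- The monic quadratics with roots `x a`, `x b` and `x c`, `x d` differ by a linear function
      -- that vanishes at `z.1`. Unless its slope is zero, it has opposite signs at `x a` and `x b`,
      -- which is a crossing; slope zero forces the edges to coincide.
      have ea : (x a - x c) * (x a - x d) = -((x c + x d) - (x a + x b)) * (x a - z.1) := by
        linear_combination e1
      have eb : (x b - x c) * (x b - x d) = -((x c + x d) - (x a + x b)) * (x b - z.1) := by
        linear_combination e1
      have hm : (x c + x d) - (x a + x b) = 0 := by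
        by_contra hm
        have : 0 < ((x c + x d) - (x a + x b)) ^ 2 * ((z.1 - x a) * (x b - z.1)) := by positivity
        rw [ea, eb] at hnc
        linarith
      rw [hm] at ea
      rcases mul_eq_zero.1 (ea.trans (by ring)) with h | h
      · have hac := hinj (sub_eq_zero.1 h)
        subst hac
        have hbd : b = d := hinj (by linarith)
        exact hne (by rw [hbd])
      · have had := hinj (sub_eq_zero.1 h)
        subst had
        have hbc : b = c := hinj (by linarith)
        exact hne (by rw [hbc, Sym2.eq_swap])
    have hz2 : z.2 = z.1 ^ 2 := by linarith
    have hzw : ∀ w, z.1 = x w → parabolaPoint (x w) = z := fun w hw =>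
      Prod.ext hw.symm (by rw [hz2, hw]; rfl)
    have hl : ∃ w, z.1 = x w ∧ w ∈ s(a, b) := by
      rcases mul_eq_zero.1 hh with h | h
      · exact ⟨a, by linarith, Sym2.mem_mk_left _ _⟩
      · exact ⟨b, by linarith, Sym2.mem_mk_right _ _⟩
    have hr : ∃ w, z.1 = x w ∧ w ∈ s(c, d) := by
      have hh' : (z.1 - x c) * (x d - z.1) = 0 := by linarith
      rcases mul_eq_zero.1 hh' with h | h
      · exact ⟨c, by linarith, Sym2.mem_mk_left _ _⟩
      · exact ⟨d, by linarith, Sym2.mem_mk_right _ _⟩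
    obtain ⟨w, hw, hwe⟩ := hl
    obtain ⟨w', hw', hwe'⟩ := hr
    obtain rfl : w = w' := hinj (hw.symm.trans hw')
    exact ⟨w, ⟨hwe, hwe'⟩, hzw w hw⟩

/-- A graph whose vertices have an order without crossing edges is outerplanar. -/
theorem IsNonCrossing.isOuterplanar {W : Type*} {G : SimpleGraph W} {x : W → ℝ}
    (hx : IsNonCrossing G x) (hinj : Function.Injective x) : IsOuterplanar G := by
  set D := hx.drawing hinj with hD
  -- The region below the parabola misses all chords, is connected and unbounded, and has every
  -- vertex in its closure.
  set U : Set (ℝ × ℝ) := {z | z.2 < z.1 ^ 2} with hU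
  have hUD : U ⊆ D.supportᶜ := by
    intro z hz hzD
    rcases hzD with ⟨w, rfl⟩ | hzD
    · exact lt_irrefl _ (show x w ^ 2 < x w ^ 2 from hz)
    · simp only [Set.mem_iUnion] at hzD
      obtain ⟨e, -, u, v, rfl, h⟩ := hzD
      have := snd_sub_sq_of_mem_segment h
      have hz' : z.2 < z.1 ^ 2 := hz
      linarith
  have hconn : IsPreconnected U := by
    have : U = (fun z : ℝ × ℝ => (z.1, z.2 + z.1 ^ 2)) '' (Set.univ ×ˢ Set.Iio 0) := by
      ext z
      constructor
      · intro hz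
        have hz' : z.2 < z.1 ^ 2 := hz
        exact ⟨(z.1, z.2 - z.1 ^ 2), ⟨trivial, by simpa using hz'⟩, by simp⟩
      · rintro ⟨y, ⟨-, hy⟩, rfl⟩
        have hy' : y.2 < 0 := hy
        change y.2 + y.1 ^ 2 < y.1 ^ 2
        linarith
    rw [this]
    exact ((convex_univ.prod (convex_Iio 0)).isPreconnected).image _ (by fun_prop)
  have h0 : ((0, -1) : ℝ × ℝ) ∈ U := by
    change (-1 : ℝ) < 0 ^ 2
    norm_num
  have hsub : U ⊆ connectedComponentIn D.supportᶜ (0, -1) :=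
    hconn.subset_connectedComponentIn h0 hUD
  refine ⟨D, (0, -1), hUD h0, fun hb => ?_, fun w => ⟨?_, fun hint => ?_⟩⟩
  · obtain ⟨C, hC⟩ := isBounded_iff_forall_norm_le.1 (hb.subset hsub)
    have h1 : ((0, -(|C| + 1)) : ℝ × ℝ) ∈ U := by
      change -(|C| + 1) < (0 : ℝ) ^ 2
      have := abs_nonneg C
      linarith
    have h2 := (norm_snd_le _).trans (hC _ h1)
    simp only [norm_neg, Real.norm_eq_abs] at h2
    have h3 := le_abs_self (|C| + 1)
    have h4 := le_abs_self C
    linarith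
  · refine closure_mono hsub ?_
    have ht : Filter.Tendsto (fun s : ℝ => ((x w, x w ^ 2 - s) : ℝ × ℝ))
        (nhdsWithin 0 (Set.Ioi 0)) (nhds (x w, x w ^ 2)) := by
      have : Continuous fun s : ℝ => ((x w, x w ^ 2 - s) : ℝ × ℝ) := by fun_prop
      simpa using (this.tendsto 0).mono_left nhdsWithin_le_nhds
    refine mem_closure_of_tendsto ht ?_
    filter_upwards [self_mem_nhdsWithin] with s hs
    have hs' : (0 : ℝ) < s := hs
    change x w ^ 2 - s < x w ^ 2
    linarith
  · exact connectedComponentIn_subset _ _ (interior_subset hint) (Or.inl ⟨w, rfl⟩)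

/-! ### The cactus property -/

namespace SimpleGraph

variable {V : Type*} {G : SimpleGraph V} {I : Finset V}

theorem Connected.starClique (hG : G.Connected) (hI : ∀ v ∈ I, ∀ w ∈ I, ¬ G.Adj v w)
    (hne : Nonempty {x // x ∉ I}) : (G.starClique I).Connected := by
  refine Connected.mk fun x y => ?_
  -- The second clause covers a walk that stands at a deleted vertex: every neighbour of that vertex
  -- can replace it, since these neighbours are pairwise adjacent in the new graph.
  have key : ∀ {u w : V} (p : G.Walk u w) (hw : w ∉ I),
      (∀ h : u ∉ I, (G.starClique I).Reachable ⟨u, h⟩ ⟨w, hw⟩) ∧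
      (u ∈ I → ∀ a (h : a ∉ I), G.Adj u a → (G.starClique I).Reachable ⟨a, h⟩ ⟨w, hw⟩) := by
    intro u w p hw
    induction p with
    | nil => exact ⟨fun _ => .refl _, fun h => absurd h hw⟩
    | @cons u u' _ huv p ih =>
      have ih := ih hw
      refine ⟨fun hu => ?_, fun hu a ha hua => ?_⟩
      · by_cases hu' : u' ∈ I
        · exact ih.2 hu' u hu huv.symm
        · refine Reachable.trans (Adj.reachable ⟨fun h => huv.ne ?_, Or.inl huv⟩) (ih.1 hu')
          simpa using h
      · have hu' : u' ∉ I := fun hu' => hI _ hu _ hu' huv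
        by_cases hau : a = u'
        · subst hau; exact ih.1 hu'
        · exact Reachable.trans (Adj.reachable ⟨by simpa using hau, Or.inr ⟨u, hu, hua, huv⟩⟩)
            (ih.1 hu')
  obtain ⟨p⟩ := hG x y
  exact (key p y.2).1 x.2

/-- The edges of an acyclic graph that survive in `starClique` are bridges. -/
theorem IsAcyclic.isBridge_starClique (hG : G.IsAcyclic) {x y : {x // x ∉ I}}
    (hxy : G.Adj x y) : (G.starClique I).IsBridge s(x, y) := by
  rw [isBridge_iff]
  intro h
  have hbr := isAcyclic_iff_forall_adj_isBridge.1 hG hxy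
  rw [isBridge_iff] at hbr
  -- A new edge unfolds to a path of length two through its centre. The centre lies in `I`, unlike
  -- `x` and `y`, so this path avoids the edge `xy`.
  refine hbr (h.map_of_forall_adj (f := Subtype.val) fun a b hab => ?_)
  rw [deleteEdges_adj, Set.mem_singleton_iff] at hab
  obtain ⟨⟨-, hab | ⟨v, hv, hva, hvb⟩⟩, hne⟩ := hab
  · refine Adj.reachable ?_
    rw [deleteEdges_adj, Set.mem_singleton_iff]
    refine ⟨hab, fun h' => hne ?_⟩
    rcases Sym2.eq_iff.1 h' with ⟨h1, h2⟩ | ⟨h1, h2⟩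
    · rw [Subtype.ext h1, Subtype.ext h2]
    · rw [Subtype.ext h1, Subtype.ext h2, Sym2.eq_swap]
  · have hv' : ∀ c, s(v, c) ≠ s((x : V), (y : V)) := by
      intro c h'
      rcases Sym2.eq_iff.1 h' with ⟨rfl, -⟩ | ⟨rfl, -⟩
      · exact x.2 hv
      · exact y.2 hv
    have : ∀ c, G.Adj v c → (G.deleteEdges {s((x : V), (y : V))}).Adj v c := fun c hc => by
      rw [deleteEdges_adj, Set.mem_singleton_iff]
      exact ⟨hc, hv' c⟩
    exact (this _ hva).reachable.symm.trans (this _ hvb).reachable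

/-- The graph without the edges at `v`. -/
abbrev isolate (G : SimpleGraph V) (v : V) : SimpleGraph V := G.deleteEdges {e | v ∈ e}

theorem isolate_adj {v x y : V} (h : G.Adj x y) (hx : x ≠ v) (hy : y ≠ v) :
    (G.isolate v).Adj x y := by
  rw [deleteEdges_adj]
  refine ⟨h, fun h' => ?_⟩
  rcases Sym2.mem_iff.1 h' with rfl | rfl
  · exact hx rfl
  · exact hy rfl

/-- Distinct neighbours of `v` are in different components of the acyclic graph without `v`. -/
theorem IsAcyclic.not_reachable_isolate (hG : G.IsAcyclic) {v a b : V} (ha : G.Adj v a)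
    (hb : G.Adj v b) (hab : a ≠ b) : ¬ (G.isolate v).Reachable a b := by
  intro h
  have hbr := isAcyclic_iff_forall_adj_isBridge.1 hG ha
  rw [isBridge_iff] at hbr
  have hle : G.isolate v ≤ G.deleteEdges {s(v, a)} :=
    deleteEdges_anti (by rintro e rfl; exact Sym2.mem_mk_left _ _)
  refine hbr (Reachable.trans (Adj.reachable ?_) (h.symm.mono hle))
  rw [deleteEdges_adj, Set.mem_singleton_iff]
  refine ⟨hb, fun h' => ?_⟩
  rcases Sym2.eq_iff.1 h' with ⟨-, h'⟩ | ⟨h1, h2⟩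
  · exact hab h'.symm
  · exact ha.ne h1

/-- Only the triangle at `v` connects different components of the graph without `v`: any other edge
is a tree edge away from `v` or runs through another centre. -/
theorem reachable_isolate_of_starClique_adj {v : V} (hv : v ∈ I) {x y : {x // x ∉ I}}
    (h : (G.starClique I).Adj x y) (hN : ¬ (G.Adj v x ∧ G.Adj v y)) :
    (G.isolate v).Reachable x y := by
  have hx : (x : V) ≠ v := fun h => x.2 (h ▸ hv)
  have hy : (y : V) ≠ v := fun h => y.2 (h ▸ hv)
  obtain ⟨-, h | ⟨w, hw, hwx, hwy⟩⟩ := h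
  · exact (isolate_adj h hx hy).reachable
  · have hwv : w ≠ v := by rintro rfl; exact hN ⟨hwx, hwy⟩
    exact (isolate_adj hwx hwv hx).reachable.symm.trans (isolate_adj hwy hwv hy).reachable

/-- A walk can leave the component of a neighbour `n` of `v` only through `n`. -/
theorem IsAcyclic.mem_support_of_not_reachable (hG : G.IsAcyclic) {v : V} (hv : v ∈ I)
    {n : {x // x ∉ I}} (hn : G.Adj v n) {z a : {x // x ∉ I}} (p : (G.starClique I).Walk z a)
    (hz : (G.isolate v).Reachable n z) (ha : ¬ (G.isolate v).Reachable n a) : n ∈ p.support := by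
  induction p with
  | nil => exact absurd hz ha
  | @cons z z' _ h p ih =>
    by_cases hN : G.Adj v z ∧ G.Adj v z'
    · have : (n : V) = z := by
        by_contra hne
        exact hG.not_reachable_isolate hn hN.1 hne hz
      rw [Subtype.ext this]
      exact Walk.start_mem_support _
    · rw [Walk.support_cons]
      exact List.mem_cons_of_mem _ (ih (hz.trans (reachable_isolate_of_starClique_adj hv h hN)) ha)

/-- A path between different components of the graph without `v` that starts in a neighbour of `v`
goes to another neighbour of `v` first. -/
theorem IsAcyclic.adj_of_cons_isPath (hG : G.IsAcyclic) {v : V} (hv : v ∈ I)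
    {b z a : {x // x ∉ I}} (hb : G.Adj v b) {h : (G.starClique I).Adj b z}
    {p : (G.starClique I).Walk z a} (hp : (Walk.cons h p).IsPath)
    (ha : ¬ (G.isolate v).Reachable b a) : G.Adj v z := by
  by_contra hz
  rw [Walk.cons_isPath_iff] at hp
  exact hp.2 (hG.mem_support_of_not_reachable hv hb p
    (reachable_isolate_of_starClique_adj hv h fun h => hz h.2) ha)

open scoped Classical in
/-- A cycle whose first edge joins two neighbours of `v` is the triangle that replaces the star
at `v`. -/
theorem IsAcyclic.mem_edges_of_isCycle [Fintype V] (hG : G.IsAcyclic) {v : V} (hv : v ∈ I)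
    (hdeg : G.degree v = 3) {a b : {x // x ∉ I}} (ha : G.Adj v a) (hb : G.Adj v b)
    {h : (G.starClique I).Adj a b} {q : (G.starClique I).Walk b a} (hq : (Walk.cons h q).IsCycle)
    (e : Sym2 {x // x ∉ I}) :
    e ∈ (Walk.cons h q).edges ↔
      ∃ x y : {x // x ∉ I}, e = s(x, y) ∧ x ≠ y ∧ G.Adj v x ∧ G.Adj v y := by
  rw [Walk.cons_isCycle_iff] at hq
  obtain ⟨hpath, habq⟩ := hq
  have hR : ∀ {x y : {x // x ∉ I}}, G.Adj v x → G.Adj v y → x ≠ y →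
      ¬ (G.isolate v).Reachable x y := fun hx hy hxy =>
    hG.not_reachable_isolate hx hy fun h => hxy (Subtype.ext h)
  cases q with
  | nil => exact absurd rfl h.ne
  | @cons _ z _ h1 q =>
    -- The rest of the cycle must return to the component of `a`, and it can leave that of `b` only
    -- through `b`, so its next vertex is a neighbour of `v`. The same applies at `z`, and since `v`
    -- has only three neighbours the cycle closes at `a`.
    have hz : G.Adj v z := hG.adj_of_cons_isPath hv hb hpath (hR hb ha h.ne')
    have hza : z ≠ a := by
      rintro rfl
      exact habq (by simp [Sym2.eq_swap])
    rw [Walk.cons_isPath_iff] at hpath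
    cases q with
    | nil => exact absurd rfl hza
    | @cons _ z' _ h2 q =>
      have hz' : G.Adj v z' := hG.adj_of_cons_isPath hv hz hpath.1 (hR hz ha hza)
      have hz'b : z' ≠ b := by
        rintro rfl
        exact hpath.2 (by simp)
      have hN : ∀ x : {x // x ∉ I}, G.Adj v x → x = a ∨ x = b ∨ x = z := by
        intro x hx
        by_contra hne
        push Not at hne
        have hsub : ({x, a, b, z} : Finset {x // x ∉ I}).map (Function.Embedding.subtype _)
            ⊆ G.neighborFinset v := by
          intro y hy
          rw [mem_neighborFinset]
          simp only [Finset.mem_map, Finset.mem_insert, Finset.mem_singleton] at hy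
          obtain ⟨y, hy | hy | hy | hy, rfl⟩ := hy <;> subst hy <;> assumption
        have hcard := Finset.card_le_card hsub
        rw [Finset.card_map, card_neighborFinset_eq_degree, hdeg,
          Finset.card_insert_of_notMem (by simp [hne]),
          Finset.card_insert_of_notMem (by simp [h.ne, hza.symm]),
          Finset.card_insert_of_notMem (by simp [h1.ne]), Finset.card_singleton] at hcard
        omega
      obtain rfl : z' = a := by
        rcases hN z' hz' with h | h | h
        · exact h
        · exact absurd h hz'b
        · exact absurd h h2.ne'
      have hq : q = .nil := by
        have := hpath.1
        rw [Walk.cons_isPath_iff] at this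
        exact (Walk.isPath_iff_nil.1 this.1).eq_nil
      subst hq
      simp only [Walk.edges_cons, Walk.edges_nil, List.mem_cons, List.not_mem_nil, or_false]
      constructor
      · rintro (rfl | rfl | rfl)
        · exact ⟨_, _, rfl, h.ne, ha, hb⟩
        · exact ⟨_, _, rfl, h1.ne, hb, hz⟩
        · exact ⟨_, _, rfl, h2.ne, hz, ha⟩
      · rintro ⟨x, y, rfl, hxy, hx, hy⟩
        rcases hN x hx with rfl | rfl | rfl <;> rcases hN y hy with rfl | rfl | rfl <;>
          simp_all [Sym2.eq_swap]

theorem Walk.toSubgraph_eq_of_mem_edges_iff {W : Type*} {H : SimpleGraph W} {a b : W}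
    {p : H.Walk a a} {q : H.Walk b b} (hp : ¬ p.Nil) (hq : ¬ q.Nil)
    (h : ∀ e, e ∈ p.edges ↔ e ∈ q.edges) : p.toSubgraph = q.toSubgraph := by
  refine Subgraph.ext ?_ ?_
  · ext x
    rw [Walk.mem_verts_toSubgraph, Walk.mem_verts_toSubgraph,
      Walk.mem_support_iff_exists_mem_edges_of_not_nil hp,
      Walk.mem_support_iff_exists_mem_edges_of_not_nil hq]
    simp only [h]
  · ext x y
    rw [Walk.adj_toSubgraph_iff_mem_edges, Walk.adj_toSubgraph_iff_mem_edges, h]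

open scoped Classical in
/-- Replacing stars of degree three of a tree by triangles gives a cactus. -/
theorem IsTree.isCactus_starClique [Fintype V] (hG : G.IsTree)
    (hI : ∀ v ∈ I, ∀ w ∈ I, ¬ G.Adj v w) (hdeg : ∀ v ∈ I, G.degree v = 3)
    (hne : Nonempty {x // x ∉ I}) : IsCactus (G.starClique I) := by
  refine ⟨hG.connected.starClique hI hne, ?_⟩
  have key : ∀ {a : {x // x ∉ I}} (p : (G.starClique I).Walk a a), p.IsCycle → ∃ v ∈ I,
      ∀ e, e ∈ p.edges ↔ ∃ x y : {x // x ∉ I}, e = s(x, y) ∧ x ≠ y ∧ G.Adj v x ∧ G.Adj v y := by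
    intro a p hp
    cases p with
    | nil => exact absurd rfl hp.ne_nil
    | @cons _ b _ h q =>
      obtain ⟨-, h' | ⟨v, hv, hva, hvb⟩⟩ := id h
      · exact absurd (by simp) ((hG.isAcyclic.isBridge_starClique h').notMem_edges_of_isCycle hp)
      · exact ⟨v, hv, hG.isAcyclic.mem_edges_of_isCycle hv (hdeg v hv) hva hvb hp⟩
  intro a b p q hp hq hpq x y hxp hxq hyp hyq
  obtain ⟨v, hv, hvp⟩ := key p hp
  obtain ⟨w, hw, hwq⟩ := key q hq
  have hvw : v ≠ w := by
    rintro rfl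
    exact hpq (Walk.toSubgraph_eq_of_mem_edges_iff hp.not_nil hq.not_nil fun e =>
      (hvp e).trans (hwq e).symm)
  have hN : ∀ {a : {x // x ∉ I}} {p : (G.starClique I).Walk a a} {v : V}, p.IsCycle →
      (∀ e, e ∈ p.edges ↔ ∃ x y : {x // x ∉ I}, e = s(x, y) ∧ x ≠ y ∧ G.Adj v x ∧ G.Adj v y) →
      ∀ z ∈ p.support, G.Adj v z := by
    intro a p v hp hv z hz
    obtain ⟨e, he, hze⟩ := (Walk.mem_support_iff_exists_mem_edges_of_not_nil hp.not_nil).1 hz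
    obtain ⟨x, y, rfl, -, hx, hy⟩ := (hv e).1 he
    rcases Sym2.mem_iff.1 hze with rfl | rfl
    · exact hx
    · exact hy
  by_contra hxy
  have hx := hN hq hwq x hxq
  have hy := hN hq hwq y hyq
  have hxv : (x : V) ≠ v := fun h => x.2 (h ▸ hv)
  have hyv : (y : V) ≠ v := fun h => y.2 (h ▸ hv)
  -- The path through `w` joins `x` and `y`, two neighbours of `v`, without passing through `v`.
  exact hG.isAcyclic.not_reachable_isolate (hN hp hvp x hxp) (hN hp hvp y hyp)
    (fun h => hxy (Subtype.ext h))
    ((isolate_adj hx hvw.symm hxv).reachable.symm.trans (isolate_adj hy hvw.symm hyv).reachable)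

end SimpleGraph

/-! ### Combining the constructions -/

namespace CapGraph

open scoped Classical in
/-- A tree with `k ≥ 2` terminals has a mimicking network on at most `3 k / 2 - 1` vertices
that is an outerplanar cactus. -/
theorem exists_outerplanar_cactus {κ : Type*} [Fintype κ] (hκ : 2 ≤ Fintype.card κ)
    {V : Type u} [Fintype V] (T : CapGraph V) (τ : κ ↪ V) (hT : T.graph.IsTree) :
    ∃ (W : Type u) (_ : Fintype W) (H : CapGraph W) (ι : κ ↪ W),
      (∀ U, H.minCut ι U = T.minCut τ U) ∧ IsOuterplanar H.graph ∧ IsCactus H.graph ∧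
        2 * Fintype.card W + 2 ≤ 3 * Fintype.card κ := by
  have : Nonempty κ := Fintype.card_pos_iff.1 (by omega)
  obtain ⟨V', _, T', τ', -, -, -, hmin, hT', hdeg⟩ :=
    exists_contraction_three_le_degree _ V T τ hT rfl
  have : Nontrivial V' := Fintype.one_lt_card_iff_nontrivial.1
    (lt_of_lt_of_le hκ (Fintype.card_le_of_embedding τ'))
  set R : Finset V' := Finset.univ.map τ' with hR
  have hcard := hT'.two_mul_card_add_two_le R fun v hv => hdeg v (by simpa [hR] using hv)
  set D := Finset.univ.filter fun v => v ∉ R ∧ T'.graph.degree v = 3 with hD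
  -- The larger colour class of the candidates `D` is independent and has at least `D.card / 2`
  -- members; deleting it cancels the last term of `hcard`.
  obtain ⟨C⟩ := hT'.colorable_two
  obtain ⟨i, hi⟩ : ∃ i, D.card ≤ 2 * (D.filter fun v => C v = i).card := by
    have h := Finset.card_eq_sum_card_fiberwise (f := C) (s := D) (t := Finset.univ) (by simp)
    rw [Fin.sum_univ_two] at h
    by_contra! hlt
    have h0 := hlt 0
    have h1 := hlt 1
    omega
  set I := D.filter fun v => C v = i with hIdef
  have hI : ∀ v ∈ I, ∀ w ∈ I, ¬ T'.graph.Adj v w := by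
    intro v hv w hw hvw
    exact C.valid hvw ((Finset.mem_filter.1 hv).2.trans (Finset.mem_filter.1 hw).2.symm)
  have hI3 : ∀ v ∈ I, v ∉ R ∧ T'.graph.degree v = 3 := fun v hv =>
    (Finset.mem_filter.1 (Finset.mem_filter.1 hv).1).2
  have hI3' := fun v hv => (hI3 v hv).2
  let ι : κ ↪ {x // x ∉ I} := ⟨fun t => ⟨τ' t, fun h => (hI3 _ h).1 (by simp [hR])⟩,
    fun s t h => τ'.injective (congrArg Subtype.val h)⟩
  obtain ⟨x, hinj, hx⟩ := hT'.exists_isNonCrossing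
  refine ⟨{x // x ∉ I}, inferInstance, T'.starTriangle I hI3', ι,
    fun U => (T'.minCut_starTriangle hI hI3' (fun _ => rfl) U).trans (hmin U),
    (hx.starClique hinj hI3').isOuterplanar (hinj.comp Subtype.val_injective),
    hT'.isCactus_starClique hI hI3' ⟨ι (Classical.arbitrary κ)⟩, ?_⟩
  have h1 : Fintype.card {x // x ∉ I} = Fintype.card V' - I.card := by
    rw [Fintype.card_subtype_compl, Fintype.card_coe]
  have h2 : I.card ≤ Fintype.card V' := Finset.card_le_univ _
  rw [hR, Finset.card_map, Finset.card_univ] at hcard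
  omega

end CapGraph

theorem mainTheorem4 :
    -- upper bound for contraction-based mimicking networks
    (∀ (V : Type u) [Fintype V] (T : CapGraph V) (K : Finset V),
      T.graph.IsTree → K.Nonempty →
      ∃ (W : Type u) (_ : Fintype W) (H : CapGraph W) (ι : K ↪ W),
        T.IsContractionMimicking K H ι ∧ H.graph.IsTree ∧
        Fintype.card W ≤ 2 * K.card - 1 ∧
        (2 ≤ K.card → Fintype.card W ≤ 2 * K.card - 2)) ∧
    -- tightness: uniform 3-regular trees with any number `k ≥ 2` of leaves exist ...
    (∀ k : ℕ, 2 ≤ k → ∃ (V : Type u) (_ : Fintype V) (T : CapGraph V) (K : Finset V),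
      T.IsUniformCubicTree K ∧ K.card = k) ∧
    -- ... and all their contraction-based mimicking networks have at least `2 k - 2` vertices
    (∀ (V : Type u) [Fintype V] (T : CapGraph V) (K : Finset V),
      T.IsUniformCubicTree K →
      ∀ (W : Type w) [Fintype W] (H : CapGraph W) (ι : K ↪ W),
        T.IsContractionMimicking K H ι → 2 * K.card - 2 ≤ Fintype.card W) ∧
    -- outerplanar (cactus) mimicking networks
    (∀ (V : Type u) [Fintype V] (T : CapGraph V) (K : Finset V),
      T.graph.IsTree → 3 ≤ K.card →
      ∃ (W : Type u) (_ : Fintype W) (H : CapGraph W) (ι : K ↪ W),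
        T.IsMimicking K H ι ∧ IsOuterplanar H.graph ∧ IsCactus H.graph ∧
        (Fintype.card W : ℝ) ≤ 13 * (K.card : ℝ) / 8 - 3 / 2) := by
  classical
  refine ⟨fun V _ T K hT hK => ?_, CapGraph.exists_isUniformCubicTree,
    fun V _ T K h W _ H ι hH => ?_, fun V _ T K hT hK => ?_⟩
  · have : Nonempty K := hK.coe_sort
    obtain ⟨W, _, H, ι, f, hf, hmap, hmin, htree, hdeg⟩ :=
      CapGraph.exists_contraction_three_le_degree _ V T
        (Function.Embedding.subtype (· ∈ K)) hT rfl
    -- The degree count needs at least two vertices. A one-vertex network occurs only for one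
    -- terminal, where `2k - 1 = 1`.
    have hcard : Fintype.card W ≤ 2 * K.card - 2 ∨ Fintype.card W ≤ 1 := by
      rcases subsingleton_or_nontrivial W with hW | hW
      · exact Or.inr (Fintype.card_le_one_iff_subsingleton.2 hW)
      · left
        set R : Finset W := Finset.univ.map ι with hR
        have h1 := htree.two_mul_card_add_two_le R fun v hv => by
          convert hdeg v (by simpa [hR] using hv)
        have h2 : R.card + (Finset.univ.filter fun v => v ∉ R ∧ H.graph.degree v = 3).card
            ≤ Fintype.card W := by
          rw [← Finset.card_union_of_disjoint]
          · exact Finset.card_le_univ _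
          · rw [Finset.disjoint_left]
            intro v hv hv'
            exact (Finset.mem_filter.1 hv').2.1 hv
        have h3 : R.card = K.card := by
          rw [hR, Finset.card_map, Finset.card_univ, Fintype.card_coe]
        have h4 : 2 * Fintype.card W + 2 ≤ 3 * R.card +
            (Finset.univ.filter fun v => v ∉ R ∧ H.graph.degree v = 3).card := by convert h1
        omega
    have hpos := hK.card_pos
    have hle := Fintype.card_le_of_embedding ι
    rw [Fintype.card_coe] at hle
    exact ⟨W, _, H, ι, ⟨⟨f, hf, hmap⟩, hmin⟩, htree, by omega, by omega⟩
  · obtain ⟨⟨f, hf, hmap⟩, hmim⟩ := hH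
    have h1 := Fintype.card_le_of_injective f (h.injective hf hmap hmim)
    have h2 := h.card_add_two
    omega
  · obtain ⟨W, _, H, ι, hmin, hout, hcac, hcard⟩ :=
      CapGraph.exists_outerplanar_cactus (by rw [Fintype.card_coe]; omega) T
        (Function.Embedding.subtype (· ∈ K)) hT
    refine ⟨W, _, H, ι, hmin, hout, hcac, ?_⟩
    rw [Fintype.card_coe] at hcard
    -- The bound `3k/2 - 1` is at most `13k/8 - 3/2` for `k ≥ 4`. For `k = 3` integrality is needed:
    -- `7/2` rounds down to 3, which is below `27/8`.
    have h8 : 8 * Fintype.card W + 12 ≤ 13 * K.card := by omega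
    have h8' : (8 * Fintype.card W + 12 : ℝ) ≤ 13 * K.card := by exact_mod_cast h8
    linarith
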